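/- A cube complex $X$ (of arbitrary, possibly infinite, dimension) is CAT(0) if it is simply connected and all its vertex links are flag complexes. Let $\mathcal H(X)$ be its set of half-spaces, $\overline H$ the half-space complementary to $H$, and $d$ the combinatorial distance on vertices. Call $H,K$ transverse if $H\cap K$, $H\cap\overline K$, $\overline H\cap K$, $\overline H\cap\overline K$ all contain a vertex. Let $g$ be a hyperbolic automorphism of $X$: $gH\neq\overline H$ for every half-space $H$, and $\ell_g=\min_x d(x,gx)>0$, where $x$ ranges over the vertices. A combinatorial axis of $g$ is a bi-infinite edge geodesic on which $g$ acts as a translation by $\ell_g$, oriented in the direction of translation. Let $A_g^+$ be the set of half-spaces $H$ such that some axis has an oriented edge $(x,y)$ with $x\notin H$, $y\in H$, and let $A_g=A_g^+\cup\{\overline H: H\in A_g^+\}$ be the half-space axis of $g$. The essential characteristic set $X_g^{\mathrm{ess}}$ is the cube complex $X(A_g)$ given by the Sageev construction. Its vertices are the subsets $\sigma\subseteq A_g$ that contain exactly one of $H,\overline H$ for each $H\in A_g$, contain no two disjoint half-spaces, and differ in only finitely many elements from $\pi(v)=\{H\in A_g: v\in H\}$ for some (equivalently, every) vertex $v$ of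 $X$. Two vertices are adjacent if they differ by replacing one $H$ with $\overline H$, and there is a cube wherever the $1$-skeleton of a cube is present. Each $H\in A_g$ defines the half-space $\{\sigma : H\in\sigma\}$ of $X_g^{\mathrm{ess}}$. The minimal set $M_g$ is the full subcomplex of $X$ spanned by the vertices $x$ with $d(x,gx)=\ell_g$, and the essential minimal set $M_g^{\mathrm{ess}}\subseteq X_g^{\mathrm{ess}}$ is the image of $M_g$ under the projection induced by $v\mapsto\pi(v)$. Say that $\langle g\rangle$ acts non-transversely on $X_g^{\mathrm{ess}}$ if for every $H\in A_g$ the half-spaces of $X_g^{\mathrm{ess}}$ defined by $H$ and $gH$ are not transverse in $X_g^{\mathrm{ess}}$. **Proposition.** $M_g^{\mathrm{ess}}=X_g^{\mathrm{ess}}$ if and only if $\langle g\rangle$ acts non-transversely on $X_g^{\mathrm{ess}}$. Moreover, $\langle g\rangle$ acts non-transversely on $X_g^{\mathrm{ess}}$ if and only if there is no $H\in A_g$ such that $H$ and $gH$ are transverse in $X$. -/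

import Mathlib

/-- A face of the combinatorial cube `{0,1}^n`: fix some of the coordinates. -/
def IsCubeFace {n : ℕ} (F : Set (Fin n → Bool)) : Prop :=
  ∃ (I : Set (Fin n)) (a : Fin n → Bool), F = {x | ∀ i ∈ I, x i = a i}

/-- A cube complex with vertex set `V`, of arbitrary (possibly infinite) dimension, recorded by the
vertex sets of its cubes. Every cube is identified with some `{0,1}^n` in such a way that the cubes
contained in it are exactly its faces, and two cubes that meet do so in a common face. -/
structure CubeComplex (V : Type*) where
  cubes : Set (Set V)
  singleton_mem : ∀ v : V, {v} ∈ cubes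
  exists_chart : ∀ C ∈ cubes, ∃ (n : ℕ) (φ : (Fin n → Bool) → V),
    Function.Injective φ ∧ Set.range φ = C ∧
      ∀ S ⊆ C, (S ∈ cubes ↔ ∃ F : Set (Fin n → Bool), IsCubeFace F ∧ S = φ '' F)
  inter_mem : ∀ C ∈ cubes, ∀ D ∈ cubes, (C ∩ D).Nonempty → C ∩ D ∈ cubes

/-- Two subsets of the vertex set are transverse if all four intersections of one of them or its
complement with the other or its complement are non-empty. -/
def Transverse {V : Type*} (H K : Set V) : Prop :=
  (H ∩ K).Nonempty ∧ (H ∩ Kᶜ).Nonempty ∧ (Hᶜ ∩ K).Nonempty ∧ (Hᶜ ∩ Kᶜ).Nonempty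

namespace CubeComplex

variable {V : Type*} (X : CubeComplex V)

/-- The `1`-skeleton. -/
def graph : SimpleGraph V where
  Adj x y := x ≠ y ∧ {x, y} ∈ X.cubes
  symm := ⟨fun x y h => ⟨h.1.symm, by rw [Set.pair_comm]; exact h.2⟩⟩
  loopless := ⟨fun _ h => h.1 rfl⟩

/-- `a, b, c, d` are the vertices of a square of `X`, in cyclic order. -/
def IsSquare (a b c d : V) : Prop :=
  {a, b, c, d} ∈ X.cubes ∧ a ≠ c ∧ b ≠ d ∧
    X.graph.Adj a b ∧ X.graph.Adj b c ∧ X.graph.Adj a d ∧ X.graph.Adj d c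

/-- The simplices (including the empty one) of the link of the vertex `v`. The vertices of the link
are the edges of `X` at `v`, represented by their other end points; every cube `C` that contains
`v` contributes the simplex spanned by the edges of `C` at `v`. -/
def linkSimplices (v : V) : Set (Set V) :=
  {S | ∃ C ∈ X.cubes, v ∈ C ∧ S = {w | w ∈ C ∧ X.graph.Adj v w}}

/-- Non-positive curvature: every vertex link is a flag complex, that is, finitely many vertices of
the link that are pairwise joined by edges of the link span a simplex of the link. -/
def IsNonpositivelyCurved : Prop :=
  ∀ (v : V) (S : Set V), S.Finite → (∀ a ∈ S, {a} ∈ X.linkSimplices v) →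
    (∀ a ∈ S, ∀ b ∈ S, a ≠ b → {a, b} ∈ X.linkSimplices v) → S ∈ X.linkSimplices v

/-- Homotopy of edge paths relative to their end points: generated by removing (or inserting)
backtracks and by pushing a path across a square. -/
inductive Homotopic : ∀ {x y : V}, X.graph.Walk x y → X.graph.Walk x y → Prop
  | refl {x y : V} (p : X.graph.Walk x y) : Homotopic p p
  | symm {x y : V} {p q : X.graph.Walk x y} : Homotopic p q → Homotopic q p
  | trans {x y : V} {p q r : X.graph.Walk x y} : Homotopic p q → Homotopic q r → Homotopic p r
  | cons {x y z : V} (h : X.graph.Adj x y) {p q : X.graph.Walk y z} :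
      Homotopic p q → Homotopic (SimpleGraph.Walk.cons h p) (SimpleGraph.Walk.cons h q)
  | backtrack {x y z : V} (h : X.graph.Adj x y) (p : X.graph.Walk x z) :
      Homotopic (SimpleGraph.Walk.cons h (SimpleGraph.Walk.cons h.symm p)) p
  | square {a b c d z : V} (_ : X.IsSquare a b c d)
      (hab : X.graph.Adj a b) (hbc : X.graph.Adj b c)
      (had : X.graph.Adj a d) (hdc : X.graph.Adj d c) (p : X.graph.Walk c z) :
      Homotopic (SimpleGraph.Walk.cons hab (SimpleGraph.Walk.cons hbc p))
        (SimpleGraph.Walk.cons had (SimpleGraph.Walk.cons hdc p))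

/-- Non-empty, connected, and every closed edge path is null-homotopic. -/
def IsSimplyConnected : Prop :=
  X.graph.Connected ∧ ∀ (x : V) (p : X.graph.Walk x x), X.Homotopic p SimpleGraph.Walk.nil

/-- A cube complex is CAT(0) if it is non-positively curved and simply connected. -/
def IsCAT0 : Prop :=
  X.IsNonpositivelyCurved ∧ X.IsSimplyConnected

/-- The two edges are opposite edges of a square. -/
def OppositeEdges (e f : Sym2 V) : Prop :=
  ∃ a b c d : V, X.IsSquare a b c d ∧ e = s(a, b) ∧ f = s(d, c)

/-- The hyperplane dual to the edge `e`, recorded by the set of all edges that it crosses. -/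
def hyperplane (e : Sym2 V) : Set (Sym2 V) :=
  {f | Relation.EqvGen X.OppositeEdges e f}

/-- A half-space, recorded by its set of vertices: a connected component of the complement of a
hyperplane. The complementary half-space of `H` is `Hᶜ`. -/
def IsHalfspace (H : Set V) : Prop :=
  ∃ e ∈ X.graph.edgeSet,
    ∃ c : (X.graph.deleteEdges (X.hyperplane e)).ConnectedComponent, H = c.supp

/-- The interval `[x, y]`: the half-spaces that contain `y` but not `x`. If `x, y` are adjacent,
its unique element is the half-space dual to the oriented edge `(x, y)`. -/
def interval (x y : V) : Set (Set V) :=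
  {H | X.IsHalfspace H ∧ y ∈ H ∧ x ∉ H}

/-- A permutation of the vertices that induces an automorphism of the cube complex. -/
def IsAutomorphism (g : Equiv.Perm V) : Prop :=
  ∀ C : Set V, g '' C ∈ X.cubes ↔ C ∈ X.cubes

/-- `g` maps no half-space to its complementary half-space. -/
def ActsWithoutInversion (g : Equiv.Perm V) : Prop :=
  ∀ H : Set V, X.IsHalfspace H → g '' H ≠ Hᶜ

/-- The translation distance: the minimum over all vertices `v` of the combinatorial distance from
`v` to `g v`. -/
noncomputable def translationDistance (g : Equiv.Perm V) : ℕ :=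
  sInf (Set.range fun v : V => X.graph.dist v (g v))

/-- A hyperbolic automorphism: it acts without inversion and has positive translation distance. -/
structure IsHyperbolic (g : Equiv.Perm V) : Prop where
  isAutomorphism : X.IsAutomorphism g
  actsWithoutInversion : X.ActsWithoutInversion g
  translationDistance_pos : 0 < X.translationDistance g

/-- A combinatorial axis, parametrized in the forward direction: a bi-infinite geodesic on which
`g` acts as the translation by `translationDistance g`. -/
def IsCombinatorialAxis (g : Equiv.Perm V) (γ : ℤ → V) : Prop :=
  (∀ i j : ℤ, X.graph.dist (γ i) (γ j) = (i - j).natAbs) ∧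
    ∀ i : ℤ, g (γ i) = γ (i + X.translationDistance g)

/-- The positive half-space axis: half-spaces dual to positively oriented edges of axes. -/
def positiveAxis (g : Equiv.Perm V) : Set (Set V) :=
  {H | ∃ γ : ℤ → V, X.IsCombinatorialAxis g γ ∧ ∃ i : ℤ, H ∈ X.interval (γ i) (γ (i + 1))}

/-- The full half-space axis: the positive half-space axis and the complementary half-spaces. -/
def halfspaceAxis (g : Equiv.Perm V) : Set (Set V) :=
  X.positiveAxis g ∪ {H | Hᶜ ∈ X.positiveAxis g}

/-- The cubes of the minimal set of `g`, the full subcomplex spanned by the vertices that realize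
the translation distance. -/
def minimalSet (g : Equiv.Perm V) : Set (Set V) :=
  {C | C ∈ X.cubes ∧ ∀ v ∈ C, X.graph.dist v (g v) = X.translationDistance g}

end CubeComplex

namespace Sageev

variable {V : Type*} (P : Set (Set V))

/-- `σ` is an ultrafilter on the collection `P` of half-spaces: it contains exactly one half-space
of each complementary pair, and no two of its elements are disjoint. -/
def IsUltrafilter (σ : Set (Set V)) : Prop :=
  σ ⊆ P ∧ (∀ H ∈ P, Xor (H ∈ σ) (Hᶜ ∈ σ)) ∧ ∀ H ∈ σ, ∀ K ∈ σ, (H ∩ K).Nonempty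

/-- The half-spaces of `P` that contain the vertex `v`. -/
def principal (v : V) : Set (Set V) :=
  {H | H ∈ P ∧ v ∈ H}

/-- The vertices of the cube complex `X(P)` of the Sageev construction: the ultrafilters on `P`
that differ from the one determined by a vertex in only finitely many half-spaces. -/
def vertices : Set (Set (Set V)) :=
  {σ | IsUltrafilter P σ ∧ ∃ v : V, (symmDiff σ (principal P v)).Finite}

/-- Two vertices of `X(P)` are adjacent if they differ on exactly one complementary pair. -/
def Adjacent (σ τ : Set (Set V)) : Prop :=
  ∃ H ∈ σ, τ = insert Hᶜ (σ \ {H})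

/-- The cubes of `X(P)`, recorded by their vertex sets: there is a cube wherever the `1`-skeleton
of a cube is present. -/
def cubes : Set (Set (Set (Set V))) :=
  {Q | ∃ (n : ℕ) (φ : (Fin n → Bool) → Set (Set V)),
    Function.Injective φ ∧ Set.range φ = Q ∧ (∀ a, φ a ∈ vertices P) ∧
      ∀ (a : Fin n → Bool) (i : Fin n), Adjacent (φ a) (φ (Function.update a i (!(a i))))}

/-- The half-space of `X(P)` that corresponds to `H ∈ P`, recorded by its set of vertices. -/
def halfspace (H : Set V) : Set (Set (Set V)) :=
  {σ | σ ∈ vertices P ∧ H ∈ σ}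

/-- The half-spaces of `X(P)` that correspond to `H, K ∈ P` are transverse in `X(P)`. -/
def TransverseIn (H K : Set V) : Prop :=
  (halfspace P H ∩ halfspace P K).Nonempty ∧ (halfspace P H ∩ halfspace P Kᶜ).Nonempty ∧
    (halfspace P Hᶜ ∩ halfspace P K).Nonempty ∧ (halfspace P Hᶜ ∩ halfspace P Kᶜ).Nonempty

end Sageev

namespace CubeComplex

variable {V : Type*} (X : CubeComplex V)

/-- The essential characteristic set of `g`: the cube complex of the Sageev construction on the
half-space axis of `g`, given by its cubes. -/
def essentialCharacteristicSet (g : Equiv.Perm V) : Set (Set (Set (Set V))) :=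
  Sageev.cubes (X.halfspaceAxis g)

/-- The essential minimal set of `g`: the projection of the minimal set to the essential
characteristic set, given by its cubes. The projection maps a vertex `v` to the set of those
half-spaces of the axis that contain `v`. -/
def essentialMinimalSet (g : Equiv.Perm V) : Set (Set (Set (Set V))) :=
  {Q | ∃ C ∈ X.minimalSet g, Q = Sageev.principal (X.halfspaceAxis g) '' C}

/-- The group generated by `g` acts non-transversely on the essential characteristic set. -/
def ActsNonTransversely (g : Equiv.Perm V) : Prop :=
  ∀ H ∈ X.halfspaceAxis g, ¬ Sageev.TransverseIn (X.halfspaceAxis g) H (g '' H)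

end CubeComplex

/-!
In a simply connected cube complex with flag links every edge path has a reduced form, unique up to
pushing across squares, so the `1`-skeleton is a median graph. Hence half-spaces are convex, the two
sides of a hyperplane are the sets of vertices closer to one end of any of its edges, and convex
sets of vertices are gated and have the Helly property. By the latter the convex hull of an axis of
`g` projects onto `X(A_g)`.

For `H ∈ A_g⁺` the half-spaces `H` and `gH` are transverse exactly if `gH ⊈ H`. If `gH ⊆ H` for all
such `H`, then a half-space between `x` and `gx`, with `x` in the hull of an axis, is determined by
the residue modulo the translation length `ℓ_g` of the index at which the axis crosses it; so there
are at most `ℓ_g` of them and `x` is minimal. Conversely, `gx ∈ H` for every minimal vertex `x` of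
`H`, because the orbit of `x` lies on a geodesic that ends up in `H`; if the minimal set projects
onto `X(A_g)`, this passes to all vertices of `H`.
-/

section Hypercube

variable {ι : Type*} [DecidableEq ι]

/-- The neighbour of a vertex of the combinatorial cube `{0,1}^ι` in direction `i`: the coordinate
`i` is changed. -/
def flipCoord (a : ι → Bool) (i : ι) : ι → Bool :=
  Function.update a i (!(a i))

@[simp] lemma flipCoord_same (a : ι → Bool) (i : ι) : flipCoord a i i = !(a i) := by
  simp [flipCoord]

lemma flipCoord_of_ne (a : ι → Bool) {i j : ι} (h : j ≠ i) : flipCoord a i j = a j := by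
  simp [flipCoord, h]

lemma flipCoord_ne (a : ι → Bool) (i : ι) : flipCoord a i ≠ a := fun h => by
  simpa using congrFun h i

@[simp] lemma flipCoord_flipCoord (a : ι → Bool) (i : ι) : flipCoord (flipCoord a i) i = a := by
  simp [flipCoord]

lemma flipCoord_comm (a : ι → Bool) (i j : ι) :
    flipCoord (flipCoord a i) j = flipCoord (flipCoord a j) i := by
  rcases eq_or_ne i j with rfl | h
  · rfl
  · simp only [flipCoord, Function.update_of_ne h, Function.update_of_ne h.symm,
      Function.update_comm h]

lemma flipCoord_injective (a : ι → Bool) : Function.Injective (flipCoord a) := by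
  intro i j h
  by_contra hij
  simpa [flipCoord_of_ne a hij] using congrFun h i

lemma flipCoord_flipCoord_ne (a : ι → Bool) {i j : ι} (h : i ≠ j) :
    flipCoord (flipCoord a i) j ≠ a := fun e =>
  h (flipCoord_injective a (by rw [← e, flipCoord_flipCoord, e]))

lemma flipCoord_comp_equiv {κ : Type*} [DecidableEq κ] (e : κ ≃ ι) (a : ι → Bool) (i : κ) :
    flipCoord (a ∘ e) i = flipCoord a (e i) ∘ e := by
  rw [flipCoord, flipCoord, Function.update_comp_equiv, e.symm_apply_apply]
  rfl

lemma eq_or_eq_flipCoord_iff {a x : ι → Bool} {i : ι} :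
    x = a ∨ x = flipCoord a i ↔ ∀ k, k ≠ i → x k = a k := by
  rw [flipCoord, Function.eq_update_iff]
  constructor
  · rintro (rfl | ⟨-, h⟩)
    exacts [fun _ _ => rfl, h]
  · intro h
    by_cases hi : x i = a i
    · exact .inl (funext fun k => if hk : k = i then hk ▸ hi else h k hk)
    · exact .inr ⟨Bool.eq_not.2 hi, h⟩

lemma eq_or_eq_flipCoord_flipCoord_iff {a x : ι → Bool} {i j : ι} :
    (x = a ∨ x = flipCoord a i) ∨ x = flipCoord (flipCoord a i) j ∨ x = flipCoord a j ↔
      ∀ k, k ≠ i → k ≠ j → x k = a k := by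
  constructor
  · rintro ((rfl | rfl) | rfl | rfl) k hi hj <;> simp [flipCoord_of_ne, hi, hj]
  · intro h
    by_cases hj : x j = a j
    · exact .inl <| eq_or_eq_flipCoord_iff.2 fun k hk =>
        if hkj : k = j then hkj ▸ hj else h k hk hkj
    · have hflip : flipCoord x j = a ∨ flipCoord x j = flipCoord a i := by
        refine eq_or_eq_flipCoord_iff.2 fun k hk => ?_
        by_cases hkj : k = j
        · rw [hkj, flipCoord_same, Bool.eq_not.2 hj, Bool.not_not]
        · rw [flipCoord_of_ne _ hkj, h k hk hkj]
      rw [← flipCoord_flipCoord x j]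
      rcases hflip with hx | hx <;> simp [hx]

lemma eq_of_forall_flipCoord [Finite ι] {β : Type*} {f : (ι → Bool) → β} {I : Set ι}
    (hf : ∀ a, ∀ i ∈ I, f (flipCoord a i) = f a) {a b : ι → Bool}
    (hab : ∀ i ∉ I, a i = b i) : f a = f b := by
  have := Fintype.ofFinite ι
  suffices key : ∀ s : Finset ι, f (s.piecewise b a) = f a by simpa using (key .univ).symm
  intro s
  induction s using Finset.induction with
  | empty => simp
  | insert j s hj ih =>
    rw [Finset.piecewise_insert]
    by_cases h : b j = s.piecewise b a j
    · rw [h, Function.update_eq_self, ih]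
    · have hjI : j ∈ I := by
        by_contra hjI
        rw [Finset.piecewise_eq_of_notMem _ _ _ hj, hab j hjI] at h
        exact h rfl
      rw [Bool.eq_not.2 h, ← ih]
      exact hf _ j hjI

end Hypercube

section CubeFace

variable {n : ℕ} (a : Fin n → Bool)

lemma isCubeFace_edge (i : Fin n) : IsCubeFace {a, flipCoord a i} :=
  ⟨{i}ᶜ, a, Set.ext fun _ => eq_or_eq_flipCoord_iff⟩

lemma isCubeFace_square (i j : Fin n) :
    IsCubeFace {a, flipCoord a i, flipCoord (flipCoord a i) j, flipCoord a j} := by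
  refine ⟨{i, j}ᶜ, a, Set.ext fun x => ?_⟩
  simpa [or_assoc] using eq_or_eq_flipCoord_flipCoord_iff (a := a) (x := x) (i := i) (j := j)

end CubeFace

namespace CubeComplex

variable {V : Type*} {X : CubeComplex V}

/-- An identification of a cube of `X` with a combinatorial cube, under which the cubes contained in
it are exactly the faces. -/
structure IsChart (X : CubeComplex V) {n : ℕ} (φ : (Fin n → Bool) → V) : Prop where
  injective : Function.Injective φ
  range_mem : Set.range φ ∈ X.cubes
  mem_cubes_iff : ∀ S ⊆ Set.range φ,
    (S ∈ X.cubes ↔ ∃ F : Set (Fin n → Bool), IsCubeFace F ∧ S = φ '' F)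

lemma exists_isChart {C : Set V} (hC : C ∈ X.cubes) :
    ∃ (n : ℕ) (φ : (Fin n → Bool) → V), X.IsChart φ ∧ Set.range φ = C := by
  obtain ⟨n, φ, hinj, rfl, hfaces⟩ := X.exists_chart C hC
  exact ⟨n, φ, ⟨hinj, hC, hfaces⟩, rfl⟩

lemma exists_ncard_cube_eq_two_pow {C : Set V} (hC : C ∈ X.cubes) : ∃ n : ℕ, C.ncard = 2 ^ n := by
  obtain ⟨n, φ, h, rfl⟩ := exists_isChart hC
  refine ⟨n, ?_⟩
  rw [← Set.image_univ, Set.ncard_image_of_injective _ h.injective, Set.ncard_univ]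
  simp

namespace IsSquare

variable {a b c d : V}

lemma rotate (h : X.IsSquare a b c d) : X.IsSquare b c d a := by
  obtain ⟨hcube, hac, hbd, hab, hbc, had, hdc⟩ := h
  refine ⟨?_, hbd, hac.symm, hbc, hdc.symm, hab.symm, had⟩
  convert hcube using 1
  grind

lemma reflect (h : X.IsSquare a b c d) : X.IsSquare a d c b := by
  obtain ⟨hcube, hac, hbd, hab, hbc, had, hdc⟩ := h
  refine ⟨?_, hac, hbd.symm, had, hdc, hab, hbc⟩
  convert hcube using 1
  grind

lemma unique {c' : V} (h : X.IsSquare a b c d) (h' : X.IsSquare a b c' d) : c = c' := by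
  by_contra hne
  have hinter := X.inter_mem _ h.1 _ h'.1 ⟨a, by simp, by simp⟩
  obtain ⟨-, hac, hbd, hab, hbc, had, hdc⟩ := h
  obtain ⟨-, hac', -, -, hbc', -, hdc'⟩ := h'
  have : ({a, b, c, d} ∩ {a, b, c', d} : Set V) = {a, b, d} := by
    have := hbc.ne; have := hdc.ne; have := hbc'.ne; have := hdc'.ne
    grind
  rw [this] at hinter
  obtain ⟨n, hn⟩ := exists_ncard_cube_eq_two_pow hinter
  rw [Set.ncard_eq_three.2 ⟨a, b, d, hab.ne, had.ne, hbd, rfl⟩] at hn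
  rcases n with _ | n
  · simp at hn
  · rw [pow_succ] at hn; omega

end IsSquare

namespace IsChart

variable {n : ℕ} {φ : (Fin n → Bool) → V}

lemma adj_iff (h : X.IsChart φ) (a b : Fin n → Bool) :
    X.graph.Adj (φ a) (φ b) ↔ ∃ i, b = flipCoord a i := by
  have hsub : {φ a, φ b} ⊆ Set.range φ := by rintro x (rfl | rfl) <;> simp
  constructor
  · rintro ⟨hne, hC⟩
    rw [h.mem_cubes_iff _ hsub, ← Set.image_pair] at hC
    obtain ⟨F, ⟨I, c, rfl⟩, hF⟩ := hC
    replace hF := h.injective.image_injective hF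
    obtain ⟨i, hi⟩ := Function.ne_iff.1 (fun e => hne (congrArg φ e) : a ≠ b)
    have ha : ∀ j ∈ I, a j = c j := hF.subset (.inl rfl)
    have hb : ∀ j ∈ I, b j = c j := hF.subset (.inr rfl)
    have hflip : flipCoord a i ∈ ({a, b} : Set (Fin n → Bool)) := by
      refine hF.superset fun j hj => ?_
      have hji : j ≠ i := by
        rintro rfl
        exact hi ((ha j hj).trans (hb j hj).symm)
      rw [flipCoord_of_ne _ hji, ha j hj]
    exact ⟨i, (hflip.resolve_left (flipCoord_ne a i)).symm⟩
  · rintro ⟨i, rfl⟩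
    refine ⟨fun e => flipCoord_ne a i (h.injective e.symm), ?_⟩
    rw [h.mem_cubes_iff _ hsub]
    exact ⟨_, isCubeFace_edge a i, by rw [Set.image_pair]⟩

lemma adj (h : X.IsChart φ) (a : Fin n → Bool) (i : Fin n) :
    X.graph.Adj (φ a) (φ (flipCoord a i)) :=
  (h.adj_iff _ _).2 ⟨i, rfl⟩

lemma isSquare (h : X.IsChart φ) (a : Fin n → Bool) {i j : Fin n} (hij : i ≠ j) :
    X.IsSquare (φ a) (φ (flipCoord a i)) (φ (flipCoord (flipCoord a i) j))
      (φ (flipCoord a j)) := by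
  refine ⟨?_, ?_, ?_, h.adj _ _, h.adj _ _, h.adj _ _, flipCoord_comm a i j ▸ h.adj _ _⟩
  · rw [h.mem_cubes_iff _ (by rintro x (rfl | rfl | rfl | rfl) <;> simp)]
    exact ⟨_, isCubeFace_square a i j, by simp [Set.image_insert_eq]⟩
  · exact fun e => flipCoord_flipCoord_ne a hij (h.injective e).symm
  · exact fun e => hij (flipCoord_injective a (h.injective e))

end IsChart

namespace Homotopic

variable {x y z : V}

lemma length_mod_two {p q : X.graph.Walk x y} (h : X.Homotopic p q) :
    p.length % 2 = q.length % 2 := by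
  induction h <;> (try simp only [SimpleGraph.Walk.length_cons]) <;> omega

lemma append_right {p q : X.graph.Walk x y} (h : X.Homotopic p q) (r : X.graph.Walk y z) :
    X.Homotopic (p.append r) (q.append r) := by
  induction h with
  | refl p => exact .refl _
  | symm _ ih => exact (ih r).symm
  | trans _ _ ih ih' => exact (ih r).trans (ih' r)
  | cons hadj _ ih => exact .cons hadj (ih r)
  | backtrack hadj w => exact .backtrack hadj _
  | square hs hab hbc had hdc w => exact .square hs hab hbc had hdc _

lemma append_left (r : X.graph.Walk x y) {p q : X.graph.Walk y z} (h : X.Homotopic p q) :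
    X.Homotopic (r.append p) (r.append q) := by
  induction r with
  | nil => exact h
  | cons hadj r ih => exact .cons hadj (ih h)

end Homotopic

namespace IsSimplyConnected

lemma homotopic (hX : X.IsSimplyConnected) {x y : V} (p q : X.graph.Walk x y) :
    X.Homotopic p q := by
  have hq : X.Homotopic (q.append (q.reverse.append p)) q := by
    simpa only [SimpleGraph.Walk.append_nil] using (hX.2 y (q.reverse.append p)).append_left q
  have hp : X.Homotopic ((q.append q.reverse).append p) p :=
    (hX.2 x (q.append q.reverse)).append_right p
  rw [SimpleGraph.Walk.append_assoc] at hq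
  exact hp.symm.trans hq

lemma length_mod_two_eq (hX : X.IsSimplyConnected) {x y : V} (p q : X.graph.Walk x y) :
    p.length % 2 = q.length % 2 :=
  (hX.homotopic p q).length_mod_two

lemma not_adj_of_adj_of_adj (hX : X.IsSimplyConnected) {x y z : V} (hxy : X.graph.Adj x y)
    (hyz : X.graph.Adj y z) : ¬ X.graph.Adj x z := fun hxz => by
  simpa using hX.length_mod_two_eq (.cons hxy (.cons hyz .nil)) (.cons hxz .nil)

end IsSimplyConnected

lemma singleton_mem_linkSimplices {v a : V} (h : X.graph.Adj v a) :
    {a} ∈ X.linkSimplices v := by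
  refine ⟨{v, a}, h.2, by simp, ?_⟩
  ext w
  simp only [Set.mem_singleton_iff, Set.mem_insert_iff, Set.mem_ofPred_eq]
  constructor
  · rintro rfl; exact ⟨Or.inr rfl, h⟩
  · rintro ⟨rfl | rfl, h'⟩
    exacts [absurd rfl h'.ne, rfl]

namespace IsSquare

lemma adj_left {a b c d : V} (h : X.IsSquare a b c d) : X.graph.Adj a b := h.2.2.2.1

lemma adj_right {a b c d : V} (h : X.IsSquare a b c d) : X.graph.Adj a d := h.2.2.2.2.2.1

lemma pair_mem_linkSimplices {v a b c : V} (h : X.IsSquare v a c b) (hX : X.IsSimplyConnected) :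
    {a, b} ∈ X.linkSimplices v := by
  refine ⟨_, h.1, by simp, ?_⟩
  ext w
  simp only [Set.mem_singleton_iff, Set.mem_insert_iff, Set.mem_ofPred_eq]
  constructor
  · rintro (rfl | rfl)
    exacts [⟨by simp, h.adj_left⟩, ⟨by simp, h.adj_right⟩]
  · rintro ⟨rfl | rfl | rfl | rfl, hw⟩
    · exact absurd rfl hw.ne
    · exact Or.inl rfl
    · exact absurd hw (hX.not_adj_of_adj_of_adj h.adj_left h.rotate.adj_left)
    · exact Or.inr rfl

end IsSquare

namespace IsCAT0

lemma exists_chart_of_pairwise (hX : X.IsCAT0) {v : V} {S : Set V} (hS : S.Finite)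
    (hadj : ∀ a ∈ S, X.graph.Adj v a)
    (hsq : ∀ a ∈ S, ∀ b ∈ S, a ≠ b → ∃ c, X.IsSquare v a c b) :
    ∃ (n : ℕ) (φ : (Fin n → Bool) → V) (o : Fin n → Bool), X.IsChart φ ∧ φ o = v ∧
      S = Set.range fun i => φ (flipCoord o i) := by
  obtain ⟨C, hC, hv, rfl⟩ := hX.1 v S hS (fun a ha => singleton_mem_linkSimplices (hadj a ha))
    (fun a ha b hb hab => (hsq a ha b hb hab).elim fun c hc => hc.pair_mem_linkSimplices hX.2)
  obtain ⟨n, φ, hφ, rfl⟩ := exists_isChart hC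
  obtain ⟨o, rfl⟩ := hv
  refine ⟨n, φ, o, hφ, rfl, ?_⟩
  ext w
  constructor
  · rintro ⟨⟨b, rfl⟩, hw⟩
    obtain ⟨i, rfl⟩ := (hφ.adj_iff _ _).1 hw
    exact ⟨i, rfl⟩
  · rintro ⟨i, rfl⟩
    exact ⟨⟨_, rfl⟩, hφ.adj _ _⟩

lemma exists_corner (hX : X.IsCAT0) {o a b c ab bc ac : V} (hab : X.IsSquare o a ab b)
    (hbc : X.IsSquare o b bc c) (hac : X.IsSquare o a ac c) :
    ∃ t, X.IsSquare a ab t ac ∧ X.IsSquare b ab t bc ∧ X.IsSquare c ac t bc := by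
  obtain ⟨n, φ, x, hφ, rfl, hS⟩ := hX.exists_chart_of_pairwise (v := o) (S := {a, b, c})
    (by simp) (by
      rintro _ (rfl | rfl | rfl)
      exacts [hab.adj_left, hbc.adj_left, hbc.adj_right]) (by
      rintro _ (rfl | rfl | rfl) _ (rfl | rfl | rfl) hne
      exacts [absurd rfl hne, ⟨_, hab⟩, ⟨_, hac⟩, ⟨_, hab.reflect⟩, absurd rfl hne, ⟨_, hbc⟩,
        ⟨_, hac.reflect⟩, ⟨_, hbc.reflect⟩, absurd rfl hne])
  obtain ⟨i, rfl⟩ := hS.subset (.inl rfl)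
  obtain ⟨j, rfl⟩ := hS.subset (.inr (.inl rfl))
  obtain ⟨k, rfl⟩ := hS.subset (.inr (.inr rfl))
  have hij : i ≠ j := by rintro rfl; exact hab.2.2.1 rfl
  have hjk : j ≠ k := by rintro rfl; exact hbc.2.2.1 rfl
  have hik : i ≠ k := by rintro rfl; exact hac.2.2.1 rfl
  obtain rfl := (hφ.isSquare x hij).unique hab
  obtain rfl := (hφ.isSquare x hjk).unique hbc
  obtain rfl := (hφ.isSquare x hik).unique hac
  refine ⟨φ (flipCoord (flipCoord (flipCoord x i) j) k), hφ.isSquare _ hjk, ?_, ?_⟩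
  · have := hφ.isSquare (flipCoord x j) hik
    rwa [flipCoord_comm x j i] at this
  · have := hφ.isSquare (flipCoord x k) hij
    rwa [flipCoord_comm x k i, flipCoord_comm x k j, flipCoord_comm (flipCoord x i) k j] at this

end IsCAT0

/-- The equivalence relation on edge paths that is generated by pushing across squares. It does not
allow the insertion or removal of backtracks, so it preserves the length. A path is recorded by the
list of its vertices, from its end to its start. -/
inductive SwapEquiv (X : CubeComplex V) : List V → List V → Prop
  | refl (p : List V) : SwapEquiv X p p
  | symm {p q : List V} : SwapEquiv X p q → SwapEquiv X q p
  | trans {p q r : List V} : SwapEquiv X p q → SwapEquiv X q r → SwapEquiv X p r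
  | cons (z : V) {p q : List V} : SwapEquiv X p q → SwapEquiv X (z :: p) (z :: q)
  | swap {z y x y' : V} (h : X.IsSquare z y x y') (l : List V) :
      SwapEquiv X (z :: y :: x :: l) (z :: y' :: x :: l)

/-- The normal form of an equivalence between paths: apart from equivalences of the paths without
their last edges, at most one square at the end of the path is used. -/
inductive TailEquiv (X : CubeComplex V) : List V → List V → Prop
  | nil : TailEquiv X [] []
  | tail (z : V) {l l' : List V} : X.SwapEquiv l l' → TailEquiv X (z :: l) (z :: l')
  | square {z y x y' : V} {l l' r : List V} : X.IsSquare z y x y' →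
      X.SwapEquiv l (y :: x :: r) → X.SwapEquiv l' (y' :: x :: r) →
      TailEquiv X (z :: l) (z :: l')

namespace TailEquiv

lemma refl : ∀ p : List V, X.TailEquiv p p
  | [] => .nil
  | z :: l => .tail z (.refl l)

lemma symm {p q : List V} (h : X.TailEquiv p q) : X.TailEquiv q p := by
  cases h with
  | nil => exact .nil
  | tail z h => exact .tail z h.symm
  | square hs h h' => exact .square hs.reflect h' h

end TailEquiv

namespace SwapEquiv

variable {p q l l' : List V} {x y z : V}

lemma length_eq (h : X.SwapEquiv p q) : p.length = q.length := by
  induction h <;> simp_all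

lemma head?_eq (h : X.SwapEquiv p q) : p.head? = q.head? := by
  induction h <;> simp_all

lemma head_eq (h : X.SwapEquiv (y :: l) (z :: l')) : y = z := by
  simpa using h.head?_eq

end SwapEquiv

/-- If two squares are used one after the other, then either they agree or they are two faces of a
`3`-cube at the end of the path, and can be replaced by a third face of it. -/
lemma TailEquiv.trans (hX : X.IsCAT0) {p q r : List V}
    (ih : ∀ l l' : List V, l.length < q.length → X.SwapEquiv l l' → X.TailEquiv l l')
    (h : X.TailEquiv p q) (h' : X.TailEquiv q r) : X.TailEquiv p r := by
  cases h with
  | nil => exact h'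
  | tail z h =>
    cases h' with
    | tail _ h' => exact .tail z (h.trans h')
    | square hs h₁ h₂ => exact .square hs (h.trans h₁) h₂
  | @square z y x y' _ l _ hs h₁ h₂ =>
    cases h' with
    | tail _ h' => exact .square hs h₁ (h'.symm.trans h₂)
    | @square _ y₁ x₁ y₂ _ _ _ hs' h₁' h₂' =>
      have hmid := h₂.symm.trans h₁'
      obtain rfl := hmid.head_eq
      cases ih _ _ (by simp [h₂.length_eq]) hmid with
      | tail _ hmid =>
        obtain rfl := hmid.head_eq
        obtain rfl := hs.rotate.rotate.rotate.unique hs'.rotate.reflect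
        exact .tail z ((h₁.trans (hmid.cons y)).trans h₂'.symm)
      | @square _ u w u' _ _ s hw hu hu' =>
        obtain rfl := hu.head_eq
        obtain rfl := hu'.head_eq
        obtain ⟨t, hz, hx, hx₁⟩ := hX.exists_corner hs.rotate.rotate.rotate hw hs'.rotate.reflect
        exact .square hz ((h₁.trans (hu.cons y)).trans (.swap hx.rotate.reflect s))
          ((h₂'.trans (hu'.cons y₂)).trans (.swap hx₁.rotate.reflect s))

namespace SwapEquiv

variable {p q l l' : List V} {x y z : V}

lemma tailEquiv (hX : X.IsCAT0) (h : X.SwapEquiv p q) : X.TailEquiv p q := by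
  obtain ⟨n, hn⟩ : ∃ n, p.length = n := ⟨_, rfl⟩
  induction n using Nat.strong_induction_on generalizing p q with
  | _ n ih =>
    induction h with
    | refl p => exact .refl p
    | symm h ih' => exact (ih' (h.length_eq ▸ hn)).symm
    | trans h _ ih₁ ih₂ =>
      have hq := h.length_eq.symm.trans hn
      exact (ih₁ hn).trans hX (fun l l' hl hll' => ih l.length (hq ▸ hl) hll' rfl) (ih₂ hq)
    | cons z h => exact .tail z h
    | swap hs l => exact .square hs (.refl _) (.refl _)

lemma tail (hX : X.IsCAT0) (h : X.SwapEquiv (z :: y :: l) (z :: y :: l')) :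
    X.SwapEquiv (y :: l) (y :: l') := by
  cases h.tailEquiv hX with
  | tail _ h => exact h
  | square hs h₁ h₂ => exact absurd (h₁.head_eq.symm.trans h₂.head_eq) hs.2.2.1

lemma exists_square (hX : X.IsCAT0) (h : X.SwapEquiv (z :: x :: l) (z :: y :: l'))
    (hxy : x ≠ y) : ∃ w r, X.IsSquare z x w y ∧ X.SwapEquiv (x :: l) (x :: w :: r) ∧
      X.SwapEquiv (y :: l') (y :: w :: r) := by
  cases h.tailEquiv hX with
  | tail _ h => exact absurd h.head_eq hxy
  | square hs h₁ h₂ =>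
    obtain rfl := h₁.head_eq
    obtain rfl := h₂.head_eq
    exact ⟨_, _, hs, h₁, h₂⟩

end SwapEquiv

/-- Up to pushing across squares, the last edge of the path `p` starts at `z`. -/
def CanPop (X : CubeComplex V) (p : List V) (z : V) : Prop :=
  ∃ y m, X.SwapEquiv p (y :: z :: m)

lemma SwapEquiv.canPop_iff {p q : List V} (h : X.SwapEquiv p q) (z : V) :
    X.CanPop p z ↔ X.CanPop q z :=
  ⟨fun ⟨y, m, hm⟩ => ⟨y, m, h.symm.trans hm⟩, fun ⟨y, m, hm⟩ => ⟨y, m, h.trans hm⟩⟩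

/-- The list `p` records a path from `v` to `x` without backtracks, even up to pushing across
squares. -/
inductive IsReducedPath (X : CubeComplex V) (v : V) : V → List V → Prop
  | start : IsReducedPath X v v [v]
  | step {x y : V} {p : List V} : X.graph.Adj x y → IsReducedPath X v x p → ¬ X.CanPop p y →
      IsReducedPath X v y (y :: p)

namespace IsReducedPath

variable {v x y z : V} {p q : List V}

lemma exists_eq_cons (h : X.IsReducedPath v x p) : ∃ l, p = x :: l := by
  cases h with
  | start => exact ⟨[], rfl⟩
  | step _ _ _ => exact ⟨_, rfl⟩

lemma of_cons_cons (h : X.IsReducedPath v x (x :: y :: p)) :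
    X.IsReducedPath v y (y :: p) ∧ ¬ X.CanPop (y :: p) x := by
  cases h with
  | step _ h hpop =>
    obtain ⟨l, hl⟩ := h.exists_eq_cons
    obtain ⟨rfl, rfl⟩ := List.cons.inj hl
    exact ⟨h, hpop⟩

lemma dist_lt_length (hX : X.graph.Connected) (h : X.IsReducedPath v x p) :
    X.graph.dist v x < p.length := by
  induction h with
  | start => simp
  | @step x y p hadj _ _ ih =>
    have := hX.dist_triangle (u := v) (v := x) (w := y)
    rw [SimpleGraph.dist_eq_one_iff_adj.2 hadj] at this
    simp only [List.length_cons]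
    omega

lemma swap (hX : X.IsCAT0) {y' : V} (hs : X.IsSquare z y x y')
    (h : X.IsReducedPath v z (z :: y :: x :: p)) : X.IsReducedPath v z (z :: y' :: x :: p) := by
  obtain ⟨hy, hz⟩ := h.of_cons_cons
  obtain ⟨hx, hpop⟩ := hy.of_cons_cons
  refine .step hs.adj_right.symm (.step hs.rotate.rotate.adj_left hx ?_) ?_
  · rintro ⟨w, m, hw⟩
    obtain rfl := hw.head_eq
    exact hz ⟨y, y' :: m, (hw.cons y).trans (.swap hs.rotate m)⟩
  · rintro ⟨w, m, hw⟩
    obtain rfl := hw.head_eq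
    obtain ⟨u, r, hu, hxy, -⟩ := hw.exists_square hX hs.2.1.symm
    obtain rfl := hu.reflect.unique hs.rotate.rotate.rotate
    exact hpop ⟨x, r, hxy⟩

lemma cons_congr (hpq : X.SwapEquiv p q)
    (ih : ∀ x, X.IsReducedPath v x p → X.IsReducedPath v x q)
    (h : X.IsReducedPath v y (z :: p)) : X.IsReducedPath v y (z :: q) := by
  cases h with
  | start =>
    obtain rfl := List.eq_nil_of_length_eq_zero hpq.length_eq.symm
    exact .start
  | step hadj h hpop => exact .step hadj (ih _ h) ((hpq.canPop_iff _).not.1 hpop)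

end IsReducedPath

lemma SwapEquiv.isReducedPath_iff (hX : X.IsCAT0) {v : V} {p q : List V} (h : X.SwapEquiv p q)
    (x : V) : X.IsReducedPath v x p ↔ X.IsReducedPath v x q := by
  induction h generalizing x with
  | refl p => rfl
  | symm _ ih => exact (ih x).symm
  | trans _ _ ih ih' => exact (ih x).trans (ih' x)
  | cons z h ih =>
    exact ⟨.cons_congr h fun x => (ih x).1, .cons_congr h.symm fun x => (ih x).2⟩
  | swap hs l =>
    constructor <;> intro h <;> obtain rfl := (List.cons.inj h.exists_eq_cons.choose_spec).1
    exacts [h.swap hX hs, h.swap hX hs.reflect]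

open Classical in
/-- Follow the edge to `z` from the end of the path `p`, cancelling a backtrack. -/
noncomputable def extend (X : CubeComplex V) (p : List V) (z : V) : List V :=
  if h : X.CanPop p z then z :: h.choose_spec.choose else z :: p

lemma extend_of_not_canPop {p : List V} {z : V} (h : ¬ X.CanPop p z) :
    X.extend p z = z :: p := by
  simp [extend, h]

namespace SwapEquiv

lemma extend_of_cons_cons (hX : X.IsCAT0) {p m : List V} {y z : V}
    (h : X.SwapEquiv p (y :: z :: m)) : X.SwapEquiv (X.extend p z) (z :: m) := by
  have hp : X.CanPop p z := ⟨y, m, h⟩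
  have key : ∀ {y' m'}, X.SwapEquiv (y :: z :: m) (y' :: z :: m') →
      X.SwapEquiv (z :: m') (z :: m) := by
    intro y' m' h'
    obtain rfl := h'.head_eq
    exact (h'.tail hX).symm
  rw [extend, dif_pos hp]
  exact key (h.symm.trans hp.choose_spec.choose_spec)

lemma extend (hX : X.IsCAT0) {p q : List V} (h : X.SwapEquiv p q) (z : V) :
    X.SwapEquiv (X.extend p z) (X.extend q z) := by
  by_cases hp : X.CanPop p z
  · obtain ⟨y, m, hy⟩ := hp
    exact (hy.extend_of_cons_cons hX).trans ((h.symm.trans hy).extend_of_cons_cons hX).symm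
  · rw [extend_of_not_canPop hp, extend_of_not_canPop ((h.canPop_iff z).not.1 hp)]
    exact h.cons z

end SwapEquiv

namespace IsReducedPath

variable {v x y a b : V} {p m : List V}

lemma canPop_cases (h : X.IsReducedPath v x p) (y : V) :
    (∃ m, X.SwapEquiv p (x :: y :: m)) ∨ ¬ X.CanPop p y := by
  refine or_iff_not_imp_right.2 fun hp => ?_
  obtain ⟨a, m, hm⟩ := not_not.1 hp
  obtain ⟨l, rfl⟩ := h.exists_eq_cons
  obtain rfl := hm.head_eq
  exact ⟨m, hm⟩

lemma extend (hX : X.IsCAT0) (h : X.IsReducedPath v x p) (hxy : X.graph.Adj x y) :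
    X.IsReducedPath v y (X.extend p y) := by
  rcases h.canPop_cases y with ⟨m, hm⟩ | hpop
  · rw [(hm.extend_of_cons_cons hX).isReducedPath_iff hX]
    exact ((hm.isReducedPath_iff hX x).1 h).of_cons_cons.1
  · rw [extend_of_not_canPop hpop]
    exact .step hxy h hpop

lemma length_extend_le (hX : X.IsCAT0) (h : X.IsReducedPath v x p) (y : V) :
    (X.extend p y).length ≤ p.length + 1 := by
  rcases h.canPop_cases y with ⟨m, hm⟩ | hpop
  · rw [(hm.extend_of_cons_cons hX).length_eq, hm.length_eq]; simp
  · simp [extend_of_not_canPop hpop]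

lemma extend_extend (hX : X.IsCAT0) (h : X.IsReducedPath v x p) :
    X.SwapEquiv (X.extend (X.extend p y) x) p := by
  rcases h.canPop_cases y with ⟨m, hm⟩ | hpop
  · refine ((hm.extend_of_cons_cons hX).extend hX x).trans ?_
    rw [extend_of_not_canPop ((hm.isReducedPath_iff hX x).1 h).of_cons_cons.2]
    exact hm.symm
  · rw [extend_of_not_canPop hpop]
    obtain ⟨l, rfl⟩ := h.exists_eq_cons
    exact (SwapEquiv.refl _).extend_of_cons_cons hX

lemma extend_square_of_canPop (hX : X.IsCAT0) (hs : X.IsSquare x a y b) {m' : List V}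
    (ha : X.SwapEquiv p (x :: a :: m)) (hb : X.SwapEquiv p (x :: b :: m')) :
    X.SwapEquiv (X.extend (X.extend p a) y) (X.extend (X.extend p b) y) := by
  obtain ⟨w, r, hw, ham, hbm⟩ := (ha.symm.trans hb).exists_square hX hs.2.2.1
  obtain rfl := hs.unique hw
  have hpa := ((ha.extend_of_cons_cons hX).trans ham).extend_of_cons_cons hX
  have hpb := ((hb.extend_of_cons_cons hX).trans hbm).extend_of_cons_cons hX
  exact hpa.trans hpb.symm

lemma extend_square_of_canPop_of_not_canPop (hX : X.IsCAT0) (hs : X.IsSquare x a y b)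
    (ha : X.SwapEquiv p (x :: a :: m)) (hb : ¬ X.CanPop p b) :
    X.SwapEquiv (X.extend (X.extend p a) y) (X.extend (X.extend p b) y) := by
  have hpop : ¬ X.CanPop (a :: m) y := by
    rintro ⟨c, r, hr⟩
    obtain rfl := hr.head_eq
    exact hb ⟨x, y :: r, (ha.trans (hr.cons x)).trans (.swap hs r)⟩
  have hpb : X.SwapEquiv (b :: p) (b :: y :: a :: m) :=
    (ha.cons b).trans (.swap hs.rotate.rotate.rotate m)
  refine ((ha.extend_of_cons_cons hX).extend hX y).trans ?_
  rw [extend_of_not_canPop hb, extend_of_not_canPop hpop]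
  exact (hpb.extend_of_cons_cons hX).symm

lemma not_canPop_cons (hX : X.IsCAT0) (h : X.IsReducedPath v x p) (hs : X.IsSquare x a y b)
    (hb : ¬ X.CanPop p b) : ¬ X.CanPop (a :: p) y := by
  rintro ⟨c, r, hr⟩
  obtain ⟨l, rfl⟩ := h.exists_eq_cons
  obtain rfl := hr.head_eq
  obtain ⟨w, s, hw, hxw, -⟩ := hr.exists_square hX hs.2.1
  obtain rfl := hw.unique hs.rotate.reflect
  exact hb ⟨x, s, hxw⟩

lemma extend_square (hX : X.IsCAT0) (h : X.IsReducedPath v x p) (hs : X.IsSquare x a y b) :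
    X.SwapEquiv (X.extend (X.extend p a) y) (X.extend (X.extend p b) y) := by
  rcases h.canPop_cases a with ⟨m, ha⟩ | ha <;> rcases h.canPop_cases b with ⟨m', hb⟩ | hb
  · exact extend_square_of_canPop hX hs ha hb
  · exact extend_square_of_canPop_of_not_canPop hX hs ha hb
  · exact (extend_square_of_canPop_of_not_canPop hX hs.reflect hb ha).symm
  · rw [extend_of_not_canPop ha, extend_of_not_canPop hb,
      extend_of_not_canPop (h.not_canPop_cons hX hs hb),
      extend_of_not_canPop (h.not_canPop_cons hX hs.reflect ha)]
    obtain ⟨l, rfl⟩ := h.exists_eq_cons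
    exact .swap hs.rotate.rotate.reflect l

end IsReducedPath

/-- Extend the path `p` by a walk, cancelling backtracks. -/
noncomputable def extendWalk (X : CubeComplex V) :
    ∀ {x y : V}, List V → X.graph.Walk x y → List V
  | _, _, p, .nil => p
  | _, _, p, .cons (v := z) _ w => extendWalk X (X.extend p z) w

lemma extendWalk_append {x y z : V} (p : List V) (w : X.graph.Walk x y) (w' : X.graph.Walk y z) :
    X.extendWalk p (w.append w') = X.extendWalk (X.extendWalk p w) w' := by
  induction w generalizing p with
  | nil => rfl
  | cons _ _ ih => exact ih _ w'

lemma SwapEquiv.extendWalk (hX : X.IsCAT0) {x y : V} (w : X.graph.Walk x y) {p q : List V}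
    (h : X.SwapEquiv p q) : X.SwapEquiv (X.extendWalk p w) (X.extendWalk q w) := by
  induction w generalizing p q with
  | nil => exact h
  | cons _ _ ih => exact ih (h.extend hX _)

lemma IsReducedPath.extendWalk (hX : X.IsCAT0) {v x y : V} (w : X.graph.Walk x y) {p : List V}
    (h : X.IsReducedPath v x p) : X.IsReducedPath v y (X.extendWalk p w) ∧
      (X.extendWalk p w).length ≤ p.length + w.length := by
  induction w generalizing p with
  | nil => exact ⟨h, le_rfl⟩
  | @cons a b c hab w ih =>
    obtain ⟨hred, hlen⟩ := ih (h.extend hX hab)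
    refine ⟨hred, hlen.trans ?_⟩
    have := h.length_extend_le hX b
    simp only [SimpleGraph.Walk.length_cons]
    omega

lemma Homotopic.extendWalk (hX : X.IsCAT0) {v x y : V} {w w' : X.graph.Walk x y}
    (hw : X.Homotopic w w') {p : List V} (h : X.IsReducedPath v x p) :
    X.SwapEquiv (X.extendWalk p w) (X.extendWalk p w') := by
  induction hw generalizing p with
  | refl w => exact .refl _
  | symm _ ih => exact (ih h).symm
  | trans _ _ ih ih' => exact (ih h).trans (ih' h)
  | cons hadj _ ih => exact ih (h.extend hX hadj)
  | backtrack _ w => exact SwapEquiv.extendWalk hX w (h.extend_extend hX)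
  | square hs _ _ _ _ w => exact SwapEquiv.extendWalk hX w (h.extend_square hX hs)

namespace IsReducedPath

variable {v x y : V} {p q : List V}

lemma exists_extendWalk_eq (h : X.IsReducedPath v x p) :
    ∃ w : X.graph.Walk v x, X.extendWalk [v] w = p := by
  induction h with
  | start => exact ⟨.nil, rfl⟩
  | step hadj _ hpop ih =>
    obtain ⟨w, rfl⟩ := ih
    exact ⟨w.append (.cons hadj .nil),
      (extendWalk_append _ _ _).trans (extend_of_not_canPop hpop)⟩

lemma swapEquiv (hX : X.IsCAT0) (hp : X.IsReducedPath v x p) (hq : X.IsReducedPath v x q) :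
    X.SwapEquiv p q := by
  obtain ⟨w, rfl⟩ := hp.exists_extendWalk_eq
  obtain ⟨w', rfl⟩ := hq.exists_extendWalk_eq
  exact (hX.2.homotopic w w').extendWalk hX .start

lemma length_eq (hX : X.IsCAT0) (h : X.IsReducedPath v x p) :
    p.length = X.graph.dist v x + 1 := by
  obtain ⟨w, hw⟩ := hX.2.1.exists_walk_length_eq_dist v x
  obtain ⟨hred, hlen⟩ := (start (X := X) (v := v)).extendWalk hX w
  refine le_antisymm ?_ (h.dist_lt_length hX.2.1)
  rw [(h.swapEquiv hX hred).length_eq, ← hw, add_comm]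
  exact hlen

end IsReducedPath

namespace IsCAT0

lemma exists_isReducedPath (hX : X.IsCAT0) (v x : V) : ∃ p, X.IsReducedPath v x p :=
  let ⟨w⟩ := hX.2.1.preconnected v x
  ⟨_, (IsReducedPath.start.extendWalk hX w).1⟩

lemma dist_eq_or (hX : X.IsCAT0) (v : V) {y z : V} (h : X.graph.Adj y z) :
    X.graph.dist v z = X.graph.dist v y + 1 ∨ X.graph.dist v y = X.graph.dist v z + 1 := by
  obtain ⟨p, hp⟩ := hX.exists_isReducedPath v y
  have hpy := hp.length_eq hX
  have hpz := (hp.extend hX h).length_eq hX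
  rcases hp.canPop_cases z with ⟨m, hm⟩ | hpop
  · rw [(hm.extend_of_cons_cons hX).length_eq] at hpz
    have := hm.length_eq
    simp only [List.length_cons] at this hpz
    omega
  · rw [extend_of_not_canPop hpop, List.length_cons] at hpz
    omega

lemma exists_isSquare_of_dist (hX : X.IsCAT0) (v : V) {z y y' : V} (h : X.graph.Adj z y)
    (h' : X.graph.Adj z y') (hne : y ≠ y') (hd : X.graph.dist v z = X.graph.dist v y + 1)
    (hd' : X.graph.dist v z = X.graph.dist v y' + 1) :
    ∃ x, X.IsSquare z y x y' ∧ X.graph.dist v y = X.graph.dist v x + 1 := by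
  obtain ⟨q, hq⟩ := hX.exists_isReducedPath v z
  have exists_pop : ∀ {y : V}, X.graph.Adj z y → X.graph.dist v z = X.graph.dist v y + 1 →
      ∃ m, X.SwapEquiv q (z :: y :: m) := by
    intro y h hd
    refine (hq.canPop_cases y).resolve_right fun hpop => ?_
    have hlen := (hq.extend hX h).length_eq hX
    rw [extend_of_not_canPop hpop, List.length_cons, hq.length_eq hX] at hlen
    omega
  obtain ⟨m, hm⟩ := exists_pop h hd
  obtain ⟨m', hm'⟩ := exists_pop h' hd'
  obtain ⟨x, r, hs, hx, -⟩ := (hm.symm.trans hm').exists_square hX hne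
  have hy := ((hm.isReducedPath_iff hX z).1 hq).of_cons_cons.1
  have hxr := ((hx.isReducedPath_iff hX y).1 hy).of_cons_cons.1
  have hlen := hx.length_eq
  rw [hy.length_eq hX, List.length_cons, hxr.length_eq hX] at hlen
  exact ⟨x, hs, by omega⟩

lemma isSquare_of_adj (hX : X.IsCAT0) {a b c d : V} (hab : X.graph.Adj a b)
    (hbc : X.graph.Adj b c) (had : X.graph.Adj a d) (hdc : X.graph.Adj d c) (hac : a ≠ c)
    (hbd : b ≠ d) : X.IsSquare a b c d := by
  have hb : X.graph.dist c b = 1 := SimpleGraph.dist_eq_one_iff_adj.2 hbc.symm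
  have hd : X.graph.dist c d = 1 := SimpleGraph.dist_eq_one_iff_adj.2 hdc.symm
  have ha : X.graph.dist c a = 2 := by
    have := hX.2.1.pos_dist_of_ne hac.symm
    rcases hX.dist_eq_or c hab with h | h <;> omega
  obtain ⟨x, hs, hx⟩ := hX.exists_isSquare_of_dist c hab had hbd (by omega) (by omega)
  obtain rfl : c = x := hX.2.1.dist_eq_zero_iff.1 (by omega)
  exact hs

end IsCAT0

end CubeComplex

section MedianGraph

variable {V : Type*} {G : SimpleGraph V}

/-- A median graph, in the characterization by which it arises from a CAT(0) cube complex: it is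
connected and bipartite, does not contain `K_{2,3}`, and satisfies the quadrangle condition. -/
structure IsMedianGraph (G : SimpleGraph V) : Prop where
  connected : G.Connected
  dist_eq_or : ∀ (v : V) {y z : V}, G.Adj y z →
    G.dist v z = G.dist v y + 1 ∨ G.dist v y = G.dist v z + 1
  quadrangle : ∀ (v : V) {z y y' : V}, G.Adj z y → G.Adj z y' → y ≠ y' →
    G.dist v z = G.dist v y + 1 → G.dist v z = G.dist v y' + 1 →
      ∃ x, G.Adj y x ∧ G.Adj y' x ∧ G.dist v y = G.dist v x + 1
  eq_of_common_neighbors : ∀ {b d a c e : V}, b ≠ d → G.Adj b a → G.Adj d a → G.Adj b c →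
    G.Adj d c → G.Adj b e → G.Adj d e → a ≠ c → a ≠ e → c = e

/-- Sets of vertices that contain all geodesics between their elements. -/
def IsGeodConvex (G : SimpleGraph V) (S : Set V) : Prop :=
  ∀ ⦃x⦄, x ∈ S → ∀ ⦃y⦄, y ∈ S → ∀ ⦃z⦄, G.dist x z + G.dist z y = G.dist x y → z ∈ S

/-- The vertices that are closer to `a` than to `b`. -/
def edgeSide (G : SimpleGraph V) (a b : V) : Set V :=
  {v | G.dist v a < G.dist v b}

/-- The `1`-skeleton of a combinatorial cube in `G`. -/
structure IsCubeMap {ι : Type*} [DecidableEq ι] (G : SimpleGraph V) (p : (ι → Bool) → V) :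
    Prop where
  injective : Function.Injective p
  adj : ∀ a i, G.Adj (p a) (p (flipCoord a i))

lemma exists_adj_dist_eq_add_one (hG : G.Connected) {x y : V} (h : x ≠ y) :
    ∃ z, G.Adj x z ∧ G.dist x y = G.dist z y + 1 := by
  obtain ⟨w, hw⟩ := hG.exists_walk_length_eq_dist x y
  cases w with
  | nil => exact absurd rfl h
  | @cons _ z _ hxz w =>
    refine ⟨z, hxz, le_antisymm ?_ ?_⟩
    · simpa [SimpleGraph.dist_eq_one_iff_adj.2 hxz, add_comm] using
        hG.dist_triangle (u := x) (v := z) (w := y)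
    · rw [← hw, SimpleGraph.Walk.length_cons]
      exact Nat.succ_le_succ (SimpleGraph.dist_le w)

namespace IsGeodConvex

lemma inter {S T : Set V} (hS : IsGeodConvex G S) (hT : IsGeodConvex G T) :
    IsGeodConvex G (S ∩ T) :=
  fun _ hx _ hy _ hz => ⟨hS hx.1 hy.1 hz, hT hx.2 hy.2 hz⟩

lemma biInter {ι : Type*} {I : Set ι} {S : ι → Set V} (hS : ∀ i ∈ I, IsGeodConvex G (S i)) :
    IsGeodConvex G (⋂ i ∈ I, S i) := fun _ hx _ hy _ hz =>
  Set.mem_iInter₂.2 fun i hi =>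
    hS i hi (Set.mem_iInter₂.1 hx i hi) (Set.mem_iInter₂.1 hy i hi) hz

end IsGeodConvex

section edgeSide

variable {a b v : V}

lemma mem_edgeSide : v ∈ edgeSide G a b ↔ G.dist v a < G.dist v b := Iff.rfl

lemma left_mem_edgeSide (h : G.Adj a b) : a ∈ edgeSide G a b := by
  rw [mem_edgeSide, SimpleGraph.dist_self, SimpleGraph.dist_eq_one_iff_adj.2 h]
  exact one_pos

lemma right_notMem_edgeSide : b ∉ edgeSide G a b := by
  simp [mem_edgeSide]

end edgeSide

namespace IsMedianGraph

lemma dist_eq_or_left (hG : IsMedianGraph G) {y z : V} (h : G.Adj y z) (v : V) :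
    G.dist z v = G.dist y v + 1 ∨ G.dist y v = G.dist z v + 1 := by
  simpa only [G.dist_comm (v := v)] using hG.dist_eq_or v h

lemma dist_eq_two (hG : IsMedianGraph G) {x y z : V} (hxy : G.Adj x y) (hyz : G.Adj y z)
    (hxz : x ≠ z) : G.dist x z = 2 := by
  have := hG.connected.pos_dist_of_ne hxz
  have hy := SimpleGraph.dist_eq_one_iff_adj.2 hxy
  rcases hG.dist_eq_or x hyz with h | h <;> omega

lemma compl_edgeSide (hG : IsMedianGraph G) {a b : V} (h : G.Adj a b) :
    (edgeSide G a b)ᶜ = edgeSide G b a := by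
  ext v
  rw [Set.mem_compl_iff, mem_edgeSide, mem_edgeSide]
  rcases hG.dist_eq_or v h with h | h <;> omega

lemma edgeSide_subset_of_square (hG : IsMedianGraph G) {a b c d : V} (hab : G.Adj a b)
    (hbc : G.Adj b c) (had : G.Adj a d) (hdc : G.Adj d c) (hac : a ≠ c) (hbd : b ≠ d) :
    edgeSide G a b ⊆ edgeSide G d c := by
  intro v hv
  by_contra hv'
  rw [mem_edgeSide] at hv hv'
  have := hG.dist_eq_or v hab
  have := hG.dist_eq_or v hbc
  have := hG.dist_eq_or v had
  have := hG.dist_eq_or v hdc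
  obtain ⟨x, hax, hcx, hx⟩ := hG.quadrangle v hab.symm hbc hac (by omega) (by omega)
  have hbx : b ≠ x := by rintro rfl; omega
  obtain rfl := hG.eq_of_common_neighbors hac hab hbc.symm had hdc.symm hax hcx hbd hbx
  omega

lemma edgeSide_eq_of_square (hG : IsMedianGraph G) {a b c d : V} (hab : G.Adj a b)
    (hbc : G.Adj b c) (had : G.Adj a d) (hdc : G.Adj d c) (hac : a ≠ c) (hbd : b ≠ d) :
    edgeSide G a b = edgeSide G d c :=
  (hG.edgeSide_subset_of_square hab hbc had hdc hac hbd).antisymm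
    (hG.edgeSide_subset_of_square hdc hbc.symm had.symm hab hbd.symm hac.symm)

lemma dist_add_dist_eq_of_forall_dist_le (hG : IsMedianGraph G) {S : Set V}
    (hS : IsGeodConvex G S) {v w : V} (hw : w ∈ S) (hmin : ∀ u ∈ S, G.dist v w ≤ G.dist v u)
    {u : V} (hu : u ∈ S) : G.dist v w + G.dist u w = G.dist v u := by
  obtain ⟨n, hn⟩ : ∃ n, G.dist u w = n := ⟨_, rfl⟩
  induction n using Nat.strong_induction_on generalizing u with
  | _ n ih =>
    by_cases huw : u = w
    · simp [huw]
    obtain ⟨u₁, hu₁, hd₁⟩ := exists_adj_dist_eq_add_one hG.connected huw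
    have hdu₁ := SimpleGraph.dist_eq_one_iff_adj.2 hu₁
    have hu₁S : u₁ ∈ S := hS hu hw (by omega)
    have ih₁ := ih _ (by omega) hu₁S rfl
    refine (hG.dist_eq_or v hu₁).elim (fun hlt => ?_) fun hgt => by omega
    -- Otherwise `u₁` is farther from `v` than both its neighbours on a geodesic of `S` through it,
    -- and the quadrangle condition replaces it by a vertex of `S` that is too close to `v`.
    have hu₁w : u₁ ≠ w := by
      rintro rfl
      have := hmin u hu
      omega
    obtain ⟨u₂, hu₂, hd₂⟩ := exists_adj_dist_eq_add_one hG.connected hu₁w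
    have hdu₂ := SimpleGraph.dist_eq_one_iff_adj.2 hu₂
    have hu₂S : u₂ ∈ S := hS hu₁S hw (by omega)
    have ih₂ := ih _ (by omega) hu₂S rfl
    have hne : u ≠ u₂ := by rintro rfl; omega
    obtain ⟨x, hux, hu₂x, hx⟩ := hG.quadrangle v hu₁.symm hu₂ hne (by omega) (by omega)
    have hxS : x ∈ S := by
      refine hS hu hu₂S ?_
      rw [hG.dist_eq_two hu₁ hu₂ hne, SimpleGraph.dist_eq_one_iff_adj.2 hux,
        SimpleGraph.dist_eq_one_iff_adj.2 hu₂x.symm]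
    have hxw := hG.dist_eq_or_left hu₂x w
    have huxw := hG.dist_eq_or_left hux w
    have ihx := ih _ (by omega) hxS rfl
    omega

lemma exists_gate (hG : IsMedianGraph G) {S : Set V} (hS : IsGeodConvex G S) (hne : S.Nonempty)
    (v : V) : ∃ w ∈ S, ∀ u ∈ S, G.dist v w + G.dist w u = G.dist v u := by
  obtain ⟨w, hw, hmin⟩ := exists_minimalFor_of_wellFoundedLT (· ∈ S) (G.dist v) hne
  refine ⟨w, hw, fun u hu => ?_⟩
  rw [G.dist_comm (u := w)]
  exact hG.dist_add_dist_eq_of_forall_dist_le hS hw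
    (fun u hu => (le_total _ _).elim id fun h => hmin hu h) hu

lemma nonempty_inter_inter (hG : IsMedianGraph G) {A B C : Set V} (hA : IsGeodConvex G A)
    (hB : IsGeodConvex G B) (hC : IsGeodConvex G C) (hAB : (A ∩ B).Nonempty)
    (hAC : (A ∩ C).Nonempty) (hBC : (B ∩ C).Nonempty) : (A ∩ B ∩ C).Nonempty := by
  obtain ⟨v, hvA, hvB⟩ := hAB
  obtain ⟨u, huA, huC⟩ := hAC
  obtain ⟨u', huB, huC'⟩ := hBC
  obtain ⟨w, hw, hgate⟩ := hG.exists_gate hC ⟨u, huC⟩ v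
  exact ⟨w, ⟨hA hvA huA (hgate u huC), hB hvB huB (hgate u' huC')⟩, hw⟩

lemma nonempty_inter_biInter (hG : IsMedianGraph G) {ι : Type*} (s : Finset ι) {f : ι → Set V}
    (hf : ∀ i ∈ s, IsGeodConvex G (f i)) (hff : ∀ i ∈ s, ∀ j ∈ s, (f i ∩ f j).Nonempty)
    {D : Set V} (hD : IsGeodConvex G D) (hDne : D.Nonempty)
    (hDf : ∀ i ∈ s, (D ∩ f i).Nonempty) : (D ∩ ⋂ i ∈ s, f i).Nonempty := by
  classical
  induction s using Finset.induction generalizing D with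
  | empty => simpa using hDne
  | insert j s _ ih =>
    simp only [Finset.forall_mem_insert] at hf hff hDf
    have := ih hf.2 (fun i hi k hk => (hff.2 i hi).2 k hk) (hD.inter hf.1) hDf.1
      (fun i hi => hG.nonempty_inter_inter hD hf.1 (hf.2 i hi) hDf.1 (hDf.2 i hi) (hff.1.2 i hi))
    rwa [Finset.set_biInter_insert, ← Set.inter_assoc]

end IsMedianGraph

lemma hammingDist_flipCoord_lt {ι : Type*} [Fintype ι] [DecidableEq ι] {a o : ι → Bool} {i : ι}
    (hi : a i ≠ o i) : hammingDist (flipCoord a i) o < hammingDist a o := by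
  refine Finset.card_lt_card ⟨fun j hj => ?_, fun h => ?_⟩
  · rcases eq_or_ne j i with rfl | hji
    · simpa using hi
    · simpa [flipCoord_of_ne a hji] using hj
  · simpa [Bool.eq_not.2 hi] using h (show i ∈ _ by simpa using hi)

namespace IsCubeMap

variable {ι : Type*} [DecidableEq ι] {p q : (ι → Bool) → V}

lemma ext [Finite ι] (hG : IsMedianGraph G) (hp : IsCubeMap G p) (hq : IsCubeMap G q)
    (o : ι → Bool) (ho : p o = q o) (hoi : ∀ i, p (flipCoord o i) = q (flipCoord o i)) :
    p = q := by
  have := Fintype.ofFinite ι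
  funext a
  obtain ⟨n, hn⟩ : ∃ n, hammingDist a o = n := ⟨_, rfl⟩
  induction n using Nat.strong_induction_on generalizing a with
  | _ n ih =>
    subst hn
    by_cases hao : a = o
    · rw [hao, ho]
    obtain ⟨i, hi⟩ := Function.ne_iff.1 hao
    by_cases hio : flipCoord a i = o
    · rw [← flipCoord_flipCoord a i, hio, hoi]
    obtain ⟨j, hj⟩ := Function.ne_iff.1 hio
    have hij : i ≠ j := by
      rintro rfl
      exact hj (by rw [flipCoord_same, Bool.eq_not.2 hi, Bool.not_not])
    have hlt := hammingDist_flipCoord_lt hi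
    have hpi := ih _ hlt _ rfl
    have hpj := ih _ (hammingDist_flipCoord_lt (flipCoord_of_ne a hij.symm ▸ hj)) _ rfl
    have hpij := ih _ ((hammingDist_flipCoord_lt hj).trans hlt) _ rfl
    have hne := flipCoord_flipCoord_ne a hij
    refine hG.eq_of_common_neighbors (a := p (flipCoord (flipCoord a i) j))
      (hp.injective.ne ((flipCoord_injective a).ne hij)) (hp.adj _ _)
      (flipCoord_comm a i j ▸ hp.adj _ _) (hp.adj _ _).symm (hp.adj _ _).symm
      (hpi ▸ (hq.adj _ _).symm) (hpj ▸ (hq.adj _ _).symm) (hp.injective.ne hne) ?_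
    exact hpij ▸ hq.injective.ne hne

end IsCubeMap

end MedianGraph

/-- The two sides of an edge, without a choice of orientation: the invariant of an edge that
determines its hyperplane. -/
def edgeSides {V : Type*} (G : SimpleGraph V) : Sym2 V → Set (Set V) :=
  Sym2.lift ⟨fun a b => {edgeSide G a b, edgeSide G b a}, fun _ _ => Set.pair_comm _ _⟩

namespace CubeComplex

variable {V : Type*} {X : CubeComplex V}

section Hyperplane

variable {a b c d x y v w : V}

lemma IsCAT0.isMedianGraph (hX : X.IsCAT0) : IsMedianGraph X.graph where
  connected := hX.2.1
  dist_eq_or := hX.dist_eq_or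
  quadrangle v _ _ _ h h' hne hd hd' :=
    let ⟨x, hs, hx⟩ := hX.exists_isSquare_of_dist v h h' hne hd hd'
    ⟨x, hs.rotate.adj_left, hs.reflect.rotate.adj_left, hx⟩
  eq_of_common_neighbors hbd hba hda hbc hdc hbc' hdc' hac hac' :=
    (hX.isSquare_of_adj hba.symm hbc hda.symm hdc hac hbd).unique
      (hX.isSquare_of_adj hba.symm hbc' hda.symm hdc' hac' hbd)

lemma IsCAT0.edgeSide_eq_of_isSquare (hX : X.IsCAT0) (h : X.IsSquare a b c d) :
    edgeSide X.graph a b = edgeSide X.graph d c := by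
  obtain ⟨-, hac, hbd, hab, hbc, had, hdc⟩ := h
  exact hX.isMedianGraph.edgeSide_eq_of_square hab hbc had hdc hac hbd

lemma IsCAT0.edgeSides_eq (hX : X.IsCAT0) {e f : Sym2 V} (h : f ∈ X.hyperplane e) :
    edgeSides X.graph e = edgeSides X.graph f := by
  change Relation.EqvGen _ _ _ at h
  induction h with
  | rel e f h =>
    obtain ⟨a, b, c, d, hs, rfl, rfl⟩ := h
    change ({edgeSide X.graph a b, edgeSide X.graph b a} : Set (Set V)) =
      {edgeSide X.graph d c, edgeSide X.graph c d}
    rw [hX.edgeSide_eq_of_isSquare hs, hX.edgeSide_eq_of_isSquare hs.rotate.reflect]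
  | refl => rfl
  | symm _ _ _ ih => exact ih.symm
  | trans _ _ _ _ _ ih ih' => exact ih.trans ih'

lemma IsCAT0.edgeSide_eq_or (hX : X.IsCAT0) (h : s(x, y) ∈ X.hyperplane s(a, b)) :
    edgeSide X.graph x y = edgeSide X.graph a b ∨ edgeSide X.graph x y = edgeSide X.graph b a := by
  have hxy : edgeSide X.graph x y ∈ edgeSides X.graph s(x, y) := Or.inl rfl
  rwa [← hX.edgeSides_eq h] at hxy

lemma IsCAT0.mem_hyperplane (hX : X.IsCAT0) (hab : X.graph.Adj a b) (hxy : X.graph.Adj x y)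
    (hx : x ∈ edgeSide X.graph a b) (hy : y ∉ edgeSide X.graph a b) :
    s(x, y) ∈ X.hyperplane s(a, b) := by
  obtain ⟨n, hn⟩ : ∃ n, X.graph.dist a x = n := ⟨_, rfl⟩
  induction n generalizing a b with
  | zero =>
    obtain rfl := hX.2.1.dist_eq_zero_iff.1 hn
    have hya := SimpleGraph.dist_eq_one_iff_adj.2 hxy.symm
    have hyb := hX.dist_eq_or y hab
    rw [mem_edgeSide] at hy
    rw [hX.2.1.dist_eq_zero_iff.1 (by omega : X.graph.dist y b = 0)]
    exact .refl _
  | succ n ih =>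
    -- Move the edge `ab` one step towards `xy`, across a square.
    obtain ⟨a', haa', ha'⟩ := exists_adj_dist_eq_add_one hX.2.1
      (by rintro rfl; simp at hn : a ≠ x)
    rw [mem_edgeSide] at hx hy
    have := hX.dist_eq_or a hxy
    have := hX.dist_eq_or b hxy
    have := hX.dist_eq_or a' hxy
    have := hX.dist_eq_or x hab
    have := hX.dist_eq_or y hab
    have := hX.dist_eq_or y haa'
    simp only [X.graph.dist_comm (u := x), X.graph.dist_comm (u := y)] at *
    have hba' : b ≠ a' := by rintro rfl; omega
    obtain ⟨b', hs, hb'⟩ := hX.exists_isSquare_of_dist y hab haa' hba'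
      (by simp only [X.graph.dist_comm (u := y)]; omega)
      (by simp only [X.graph.dist_comm (u := y)]; omega)
    have hside := hX.edgeSide_eq_of_isSquare hs
    have hopp : X.OppositeEdges s(a, b) s(a', b') := ⟨a, b, b', a', hs, rfl, rfl⟩
    refine .trans _ _ _ (.rel _ _ hopp) (ih hs.2.2.2.2.2.2 ?_ ?_ (by omega))
    · rw [← hside, mem_edgeSide]
      simpa only [X.graph.dist_comm (u := x)] using hx
    · rw [← hside, mem_edgeSide]
      simpa only [X.graph.dist_comm (u := y)] using hy

lemma IsCAT0.edgeSide_eq (hX : X.IsCAT0) (hab : X.graph.Adj a b) (hxy : X.graph.Adj x y)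
    (hx : x ∈ edgeSide X.graph a b) (hy : y ∉ edgeSide X.graph a b) :
    edgeSide X.graph x y = edgeSide X.graph a b := by
  refine (hX.edgeSide_eq_or (hX.mem_hyperplane hab hxy hx hy)).resolve_right fun h => ?_
  have hx' := left_mem_edgeSide hxy
  rw [h, ← hX.isMedianGraph.compl_edgeSide hab] at hx'
  exact hx' hx

lemma IsCAT0.deleteEdges_adj_iff (hX : X.IsCAT0) (hab : X.graph.Adj a b) :
    (X.graph.deleteEdges (X.hyperplane s(a, b))).Adj x y ↔
      X.graph.Adj x y ∧ (x ∈ edgeSide X.graph a b ↔ y ∈ edgeSide X.graph a b) := by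
  rw [SimpleGraph.deleteEdges_adj]
  refine and_congr_right fun hxy => ⟨fun h => ?_, fun h h' => ?_⟩
  · by_contra hne
    apply h
    by_cases hx : x ∈ edgeSide X.graph a b
    · exact hX.mem_hyperplane hab hxy hx (by tauto)
    · rw [Sym2.eq_swap (a := x)]
      exact hX.mem_hyperplane hab hxy.symm (by tauto) hx
  · have hx := left_mem_edgeSide hxy
    have hy := right_notMem_edgeSide (G := X.graph) (a := x) (b := y)
    rcases hX.edgeSide_eq_or h' with e | e
    · rw [e] at hx hy
      exact hy (h.1 hx)
    · rw [e, ← hX.isMedianGraph.compl_edgeSide hab] at hx hy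
      exact hy fun h'' => hx (h.2 h'')

lemma IsCAT0.reachable_of_mem_edgeSide (hX : X.IsCAT0) (hab : X.graph.Adj a b)
    (hv : v ∈ edgeSide X.graph a b) :
    (X.graph.deleteEdges (X.hyperplane s(a, b))).Reachable v a := by
  obtain ⟨n, hn⟩ : ∃ n, X.graph.dist v a = n := ⟨_, rfl⟩
  induction n generalizing v with
  | zero => rw [hX.2.1.dist_eq_zero_iff.1 hn]
  | succ n ih =>
    obtain ⟨z, hvz, hz⟩ := exists_adj_dist_eq_add_one hX.2.1 (by rintro rfl; simp at hn : v ≠ a)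
    have hzab : z ∈ edgeSide X.graph a b := by
      rw [mem_edgeSide] at hv ⊢
      have := hX.isMedianGraph.dist_eq_or_left hvz b
      omega
    exact ((hX.deleteEdges_adj_iff hab).2 ⟨hvz, iff_of_true hv hzab⟩).reachable.trans
      (ih hzab (by omega))

lemma IsCAT0.reachable_iff (hX : X.IsCAT0) (hab : X.graph.Adj a b) :
    (X.graph.deleteEdges (X.hyperplane s(a, b))).Reachable v w ↔
      (v ∈ edgeSide X.graph a b ↔ w ∈ edgeSide X.graph a b) := by
  constructor
  · rintro ⟨p⟩
    induction p with
    | nil => rfl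
    | cons h _ ih => exact ((hX.deleteEdges_adj_iff hab).1 h).2.trans ih
  · intro h
    by_cases hv : v ∈ edgeSide X.graph a b
    · exact (hX.reachable_of_mem_edgeSide hab hv).trans
        (hX.reachable_of_mem_edgeSide hab (h.1 hv)).symm
    · have hw : w ∉ edgeSide X.graph a b := mt h.2 hv
      rw [← Set.mem_compl_iff, hX.isMedianGraph.compl_edgeSide hab] at hv hw
      rw [Sym2.eq_swap]
      exact (hX.reachable_of_mem_edgeSide hab.symm hv).trans
        (hX.reachable_of_mem_edgeSide hab.symm hw).symm

end Hyperplane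

section Halfspace

variable {H : Set V} {x y : V}

lemma IsCAT0.isHalfspace_iff (hX : X.IsCAT0) :
    X.IsHalfspace H ↔ ∃ a b, X.graph.Adj a b ∧ H = edgeSide X.graph a b := by
  have supp_eq : ∀ {a b : V}, X.graph.Adj a b → ∀ v : V,
      ((X.graph.deleteEdges (X.hyperplane s(a, b))).connectedComponentMk v).supp =
        {w | w ∈ edgeSide X.graph a b ↔ v ∈ edgeSide X.graph a b} := fun hab v =>
    Set.ext fun w => SimpleGraph.ConnectedComponent.eq.trans (hX.reachable_iff hab)
  constructor
  · rintro ⟨e, he, c, rfl⟩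
    induction e with | h a b => ?_
    induction c using SimpleGraph.ConnectedComponent.ind with | h v => ?_
    rw [SimpleGraph.mem_edgeSet] at he
    rw [supp_eq he]
    by_cases hv : v ∈ edgeSide X.graph a b
    · exact ⟨a, b, he, by simp [hv]⟩
    · refine ⟨b, a, he.symm, ?_⟩
      rw [← hX.isMedianGraph.compl_edgeSide he]
      simp [hv, Set.compl_def]
  · rintro ⟨a, b, hab, rfl⟩
    refine ⟨s(a, b), hab, SimpleGraph.connectedComponentMk _ a, ?_⟩
    simp [supp_eq hab, left_mem_edgeSide hab]

lemma IsCAT0.isHalfspace_edgeSide (hX : X.IsCAT0) (h : X.graph.Adj x y) :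
    X.IsHalfspace (edgeSide X.graph x y) :=
  hX.isHalfspace_iff.2 ⟨x, y, h, rfl⟩

lemma IsCAT0.isHalfspace_compl (hX : X.IsCAT0) (h : X.IsHalfspace H) : X.IsHalfspace Hᶜ := by
  obtain ⟨a, b, hab, rfl⟩ := hX.isHalfspace_iff.1 h
  rw [hX.isMedianGraph.compl_edgeSide hab]
  exact hX.isHalfspace_edgeSide hab.symm

lemma IsCAT0.isHalfspace_eq_edgeSide (hX : X.IsCAT0) (h : X.IsHalfspace H)
    (hxy : X.graph.Adj x y) (hx : x ∈ H) (hy : y ∉ H) : H = edgeSide X.graph x y := by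
  obtain ⟨a, b, hab, rfl⟩ := hX.isHalfspace_iff.1 h
  exact (hX.edgeSide_eq hab hxy hx hy).symm

lemma IsCAT0.interval_of_adj (hX : X.IsCAT0) (hxy : X.graph.Adj x y) :
    X.interval x y = {edgeSide X.graph y x} := by
  ext H
  constructor
  · rintro ⟨hH, hy, hx⟩
    exact hX.isHalfspace_eq_edgeSide hH hxy.symm hy hx
  · rintro rfl
    exact ⟨hX.isHalfspace_edgeSide hxy.symm, left_mem_edgeSide hxy.symm, right_notMem_edgeSide⟩

lemma IsCAT0.isGeodConvex (hX : X.IsCAT0) (hH : X.IsHalfspace H) : IsGeodConvex X.graph H := by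
  intro x hx y hy z hxyz
  obtain ⟨n, hn⟩ : ∃ n, X.graph.dist x z = n := ⟨_, rfl⟩
  induction n generalizing x with
  | zero => exact hX.2.1.dist_eq_zero_iff.1 hn ▸ hx
  | succ n ih =>
    obtain ⟨w, hxw, hw⟩ := exists_adj_dist_eq_add_one hX.2.1 (by rintro rfl; simp at hn : x ≠ z)
    have htri := hX.2.1.dist_triangle (u := w) (v := z) (w := y)
    have hwy := hX.isMedianGraph.dist_eq_or_left hxw y
    refine ih (x := w) ?_ (by omega) (by omega)
    by_contra hwH
    rw [hX.isHalfspace_eq_edgeSide hH hxw hx hwH, mem_edgeSide, X.graph.dist_comm,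
      X.graph.dist_comm (u := y)] at hy
    omega

lemma interval_subset_union (x y z : V) : X.interval x z ⊆ X.interval x y ∪ X.interval y z := by
  rintro H ⟨hH, hz, hx⟩
  by_cases hy : y ∈ H
  · exact .inl ⟨hH, hy, hx⟩
  · exact .inr ⟨hH, hz, hy⟩

lemma IsCAT0.finite_interval (hX : X.IsCAT0) (x y : V) : (X.interval x y).Finite := by
  obtain ⟨w⟩ := hX.2.1.preconnected x y
  induction w with
  | nil => exact Set.finite_empty.subset fun H h => h.2.2 h.2.1
  | cons h _ ih =>
    refine .subset (.union ?_ ih) (interval_subset_union _ _ _)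
    rw [hX.interval_of_adj h]
    exact Set.finite_singleton _

lemma IsCAT0.dist_le_ncard_interval (hX : X.IsCAT0) (x y : V) :
    X.graph.dist x y ≤ (X.interval x y).ncard := by
  obtain ⟨n, hn⟩ : ∃ n, X.graph.dist x y = n := ⟨_, rfl⟩
  rw [hn]
  induction n generalizing x with
  | zero => exact Nat.zero_le _
  | succ n ih =>
    obtain ⟨z, hxz, hz⟩ := exists_adj_dist_eq_add_one hX.2.1 (by rintro rfl; simp at hn : x ≠ y)
    have hnotMem : edgeSide X.graph z x ∉ X.interval z y := fun h =>
      h.2.2 (left_mem_edgeSide hxz.symm)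
    have hsub : insert (edgeSide X.graph z x) (X.interval z y) ⊆ X.interval x y := by
      rintro H (rfl | ⟨hH, hy, hzH⟩)
      · refine ⟨hX.isHalfspace_edgeSide hxz.symm, ?_, right_notMem_edgeSide⟩
        rw [mem_edgeSide, X.graph.dist_comm, X.graph.dist_comm (u := y)]
        omega
      · refine ⟨hH, hy, fun hx => hzH (hX.isGeodConvex hH hx hy ?_)⟩
        rw [SimpleGraph.dist_eq_one_iff_adj.2 hxz]
        omega
    have hcard := Set.ncard_le_ncard hsub (hX.finite_interval x y)
    rw [Set.ncard_insert_of_notMem hnotMem (hX.finite_interval z y)] at hcard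
    have := ih z (by omega)
    omega

lemma IsCAT0.adj_of_interval_subset (hX : X.IsCAT0) (h : x ≠ y) (hH : X.interval x y ⊆ {H}) :
    X.graph.Adj x y := by
  rw [← SimpleGraph.dist_eq_one_iff_adj]
  have hcard := Set.ncard_le_ncard hH (Set.finite_singleton H)
  rw [Set.ncard_singleton] at hcard
  have := hX.dist_le_ncard_interval x y
  have := hX.2.1.pos_dist_of_ne h
  omega

end Halfspace

end CubeComplex

section CubeMap

variable {V ι κ : Type*} [DecidableEq ι] [DecidableEq κ] {G : SimpleGraph V}
  {p : (ι → Bool) → V}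

lemma flipCoord_xor (o a : ι → Bool) (i : ι) :
    (fun j => xor (o j) (flipCoord a i j)) = flipCoord (fun j => xor (o j) (a j)) i := by
  ext j
  rcases eq_or_ne j i with rfl | h
  · simp
  · simp [flipCoord_of_ne _ h]

lemma extend_flipCoord {f : κ → ι} (hf : Function.Injective f) (b : κ → Bool) (c : ι → Bool)
    (k : κ) : Function.extend f (flipCoord b k) c = flipCoord (Function.extend f b c) (f k) := by
  ext i
  rcases em (∃ l, f l = i) with ⟨l, rfl⟩ | hi
  · rcases eq_or_ne l k with rfl | h
    · simp [hf.extend_apply]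
    · simp [hf.extend_apply, flipCoord_of_ne _ h, flipCoord_of_ne _ (hf.ne h)]
  · rw [flipCoord_of_ne _ fun h => hi ⟨k, h.symm⟩, Function.extend_apply' _ _ _ hi,
      Function.extend_apply' _ _ _ hi]

namespace IsCubeMap

lemma xor (hp : IsCubeMap G p) (o : ι → Bool) :
    IsCubeMap G fun a => p fun i => Bool.xor (o i) (a i) where
  injective a b h := funext fun i => Bool.xor_right_inj.1 (congrFun (hp.injective h) i)
  adj a i := by
    rw [flipCoord_xor]
    exact hp.adj _ _

lemma comp_equiv (hp : IsCubeMap G p) (e : ι ≃ κ) : IsCubeMap G fun a => p (a ∘ e) where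
  injective _ _ h := e.surjective.injective_comp_right (hp.injective h)
  adj a k := by
    have := hp.adj (a ∘ e) (e.symm k)
    rwa [flipCoord_comp_equiv, e.apply_symm_apply] at this

end IsCubeMap

/-- The half-space dual to the edges in direction `i` of the cube parametrized by `p`, on the side
where the coordinate `i` is `true`. -/
def dualSide (G : SimpleGraph V) (p : (ι → Bool) → V) (i : ι) : Set V :=
  edgeSide G (p (flipCoord (fun _ => false) i)) (p fun _ => false)

namespace IsCubeMap

variable (hG : IsMedianGraph G) (hp : IsCubeMap G p) (a : ι → Bool) {i j : ι}
include hG hp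

lemma edgeSide_flipCoord (hij : i ≠ j) :
    edgeSide G (p (flipCoord a j)) (p (flipCoord (flipCoord a i) j)) =
      edgeSide G (p a) (p (flipCoord a i)) :=
  (hG.edgeSide_eq_of_square (hp.adj _ _) (hp.adj _ _) (hp.adj _ _)
    (flipCoord_comm a i j ▸ hp.adj _ _) (hp.injective.ne (flipCoord_flipCoord_ne a hij).symm)
    (hp.injective.ne ((flipCoord_injective a).ne hij))).symm

variable [Finite ι]

lemma edgeSide_eq_dualSide (ha : a i = true) :
    edgeSide G (p a) (p (flipCoord a i)) = dualSide G p i := by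
  let side (b : ι → Bool) : Set V :=
    if b i then edgeSide G (p b) (p (flipCoord b i)) else edgeSide G (p (flipCoord b i)) (p b)
  have hside : ∀ b, ∀ j ∈ Set.univ, side (flipCoord b j) = side b := by
    intro b j _
    rcases eq_or_ne i j with rfl | hij
    · cases hb : b i <;> simp [side, hb]
    · have hb := hp.edgeSide_flipCoord hG b hij
      have hb' := hp.edgeSide_flipCoord hG (flipCoord b i) hij
      rw [flipCoord_flipCoord] at hb'
      simp only [side, flipCoord_of_ne b hij, flipCoord_comm b j i, hb, hb']
  have := eq_of_forall_flipCoord hside (a := a) (b := fun _ => false) (by simp)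
  simpa [side, ha, dualSide] using this

lemma edgeSide_eq_compl_dualSide (ha : a i = false) :
    edgeSide G (p a) (p (flipCoord a i)) = (dualSide G p i)ᶜ := by
  rw [← hp.edgeSide_eq_dualSide hG (flipCoord a i) (by simp [ha]), flipCoord_flipCoord,
    hG.compl_edgeSide (hp.adj a i).symm]

lemma mem_dualSide : p a ∈ dualSide G p i ↔ a i = true := by
  have hmem := left_mem_edgeSide (hp.adj a i)
  cases ha : a i
  · rw [hp.edgeSide_eq_compl_dualSide hG a ha] at hmem
    simpa using hmem
  · rw [hp.edgeSide_eq_dualSide hG a ha] at hmem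
    simpa using hmem

end IsCubeMap

end CubeMap

lemma exists_equiv_comp_eq_of_range_eq {α β γ : Type*} {f : α → γ} {g : β → γ}
    (hf : Function.Injective f) (hg : Function.Injective g) (h : Set.range f = Set.range g) :
    ∃ e : α ≃ β, ∀ a, g (e a) = f a := by
  refine ⟨(Equiv.ofInjective f hf).trans ((Equiv.setCongr h).trans (Equiv.ofInjective g hg).symm),
    fun a => ?_⟩
  exact Equiv.apply_ofInjective_symm hg (Equiv.setCongr h (Equiv.ofInjective f hf a))

namespace CubeComplex

variable {V : Type*} {X : CubeComplex V}

lemma IsChart.isCubeMap {n : ℕ} {φ : (Fin n → Bool) → V} (h : X.IsChart φ) :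
    IsCubeMap X.graph φ :=
  ⟨h.injective, h.adj⟩

lemma IsCAT0.range_mem_cubes (hX : X.IsCAT0) {ι : Type*} [DecidableEq ι] [Finite ι]
    {p : (ι → Bool) → V} (hp : IsCubeMap X.graph p) : Set.range p ∈ X.cubes := by
  set o : ι → Bool := fun _ => false with ho
  have hinj : Function.Injective fun i => p (flipCoord o i) :=
    hp.injective.comp (flipCoord_injective o)
  obtain ⟨m, φ, o', hφ, hφo, hS⟩ := hX.exists_chart_of_pairwise (v := p o)
    (S := Set.range fun i => p (flipCoord o i)) (Set.finite_range _)
    (by rintro _ ⟨i, rfl⟩; exact hp.adj _ _) (by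
      rintro _ ⟨i, rfl⟩ _ ⟨j, rfl⟩ hne
      have hij : i ≠ j := fun h => hne (h ▸ rfl)
      exact ⟨_, hX.isSquare_of_adj (hp.adj _ _) (hp.adj _ j) (hp.adj _ _)
        (flipCoord_comm o i j ▸ hp.adj _ _) (hp.injective.ne (flipCoord_flipCoord_ne o hij).symm)
        hne⟩)
  obtain ⟨e, he⟩ := exists_equiv_comp_eq_of_range_eq hinj
    (hφ.injective.comp (flipCoord_injective o')) hS
  have hpφ : p = fun a => φ fun j => xor (o' j) ((a ∘ e.symm) j) := by
    refine IsCubeMap.ext hX.isMedianGraph hp ((hφ.isCubeMap.xor o').comp_equiv e.symm) o ?_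
      fun i => ?_
    · simp [ho, hφo]
    · have hflip : flipCoord o i ∘ e.symm = flipCoord (o ∘ e.symm) (e i) := by
        rw [flipCoord_comp_equiv, e.symm_apply_apply]
      change _ = φ fun j => xor (o' j) ((flipCoord o i ∘ e.symm) j)
      rw [← he, hflip, flipCoord_xor]
      simp [ho]
  have hsurj : Function.Surjective fun (a : ι → Bool) j => xor (o' j) ((a ∘ e.symm) j) :=
    fun b => ⟨fun i => xor (o' (e i)) (b (e i)), by simp⟩
  rw [hpφ]
  exact (hsurj.range_comp φ).symm ▸ hφ.range_mem

end CubeComplex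

namespace Sageev

variable {V : Type*} {P : Set (Set V)}

lemma principal_mem_vertices (hP : ∀ H ∈ P, Hᶜ ∈ P) (v : V) :
    principal P v ∈ vertices P := by
  refine ⟨⟨fun H h => h.1, fun H hH => ?_, fun H hH K hK => ⟨v, hH.2, hK.2⟩⟩, v, by simp⟩
  by_cases hv : v ∈ H
  · exact .inl ⟨⟨hH, hv⟩, fun h => h.2 hv⟩
  · exact .inr ⟨⟨hP H hH, hv⟩, fun h => hv h.2⟩

lemma IsUltrafilter.principal_eq {σ : Set (Set V)} (hσ : IsUltrafilter P σ) {v : V}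
    (hv : ∀ H ∈ σ, v ∈ H) : principal P v = σ := by
  refine Set.Subset.antisymm ?_ fun H hH => ⟨hσ.1 hH, hv H hH⟩
  rintro H ⟨hHP, hvH⟩
  exact (hσ.2.1 H hHP).elim And.left fun h => absurd hvH (hv _ h.1)

lemma transverseIn_iff {H K : Set V} (hP : ∀ H ∈ P, Hᶜ ∈ P) (hH : H ∈ P) (hK : K ∈ P) :
    TransverseIn P H K ↔ Transverse H K := by
  have inter_nonempty : ∀ {H K : Set V}, H ∈ P → K ∈ P →
      ((halfspace P H ∩ halfspace P K).Nonempty ↔ (H ∩ K).Nonempty) := fun {H K} hH hK =>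
    ⟨fun ⟨_, hσ, hσ'⟩ => hσ.1.1.2.2 H hσ.2 K hσ'.2, fun ⟨v, hvH, hvK⟩ =>
      ⟨principal P v, ⟨principal_mem_vertices hP v, hH, hvH⟩, principal_mem_vertices hP v, hK, hvK⟩⟩
  rw [TransverseIn, Transverse, inter_nonempty hH hK, inter_nonempty hH (hP K hK),
    inter_nonempty (hP H hH) hK, inter_nonempty (hP H hH) (hP K hK)]

end Sageev

namespace CubeComplex

variable {V : Type*} {X : CubeComplex V}

section Projection

variable {P : Set (Set V)}

lemma IsCAT0.adjacent_principal (hX : X.IsCAT0) (hPX : ∀ H ∈ P, X.IsHalfspace H)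
    (hP : ∀ H ∈ P, Hᶜ ∈ P) {x y : V} (hxy : X.graph.Adj x y) (hmem : edgeSide X.graph x y ∈ P) :
    Sageev.Adjacent (Sageev.principal P x) (Sageev.principal P y) := by
  refine ⟨edgeSide X.graph x y, ⟨hmem, left_mem_edgeSide hxy⟩, ?_⟩
  have hcompl := hX.isMedianGraph.compl_edgeSide hxy
  ext K
  simp only [Set.mem_insert_iff, Set.mem_sdiff, Set.mem_singleton_iff]
  constructor
  · rintro ⟨hK, hy⟩
    by_cases hx : x ∈ K
    · exact .inr ⟨⟨hK, hx⟩, fun h => right_notMem_edgeSide (h ▸ hy)⟩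
    · exact .inl ((hX.isHalfspace_eq_edgeSide (hPX K hK) hxy.symm hy hx).trans hcompl.symm)
  · rintro (rfl | ⟨⟨hK, hx⟩, hne⟩)
    · exact ⟨hP _ hmem, right_notMem_edgeSide⟩
    · exact ⟨hK, by_contra fun hy => hne (hX.isHalfspace_eq_edgeSide (hPX K hK) hxy hx hy)⟩

lemma IsCAT0.principal_eq_of_adj (hX : X.IsCAT0) (hPX : ∀ H ∈ P, X.IsHalfspace H) {x y : V}
    (hxy : X.graph.Adj x y) (hx : edgeSide X.graph x y ∉ P) (hy : edgeSide X.graph y x ∉ P) :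
    Sageev.principal P x = Sageev.principal P y := by
  ext K
  refine and_congr_right fun hK => ⟨fun hxK => ?_, fun hyK => ?_⟩
  · by_contra hyK
    exact hx (hX.isHalfspace_eq_edgeSide (hPX K hK) hxy hxK hyK ▸ hK)
  · by_contra hxK
    exact hy (hX.isHalfspace_eq_edgeSide (hPX K hK) hxy.symm hyK hxK ▸ hK)

variable {ι : Type*} [DecidableEq ι] [Finite ι] {p : (ι → Bool) → V}

lemma IsCAT0.edgeSide_flipCoord_mem_iff (hX : X.IsCAT0) (hP : ∀ H ∈ P, Hᶜ ∈ P)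
    (hp : IsCubeMap X.graph p) (a : ι → Bool) (i : ι) :
    edgeSide X.graph (p a) (p (flipCoord a i)) ∈ P ↔ dualSide X.graph p i ∈ P := by
  cases ha : a i
  · rw [hp.edgeSide_eq_compl_dualSide hX.isMedianGraph a ha]
    exact ⟨fun h => compl_compl (dualSide X.graph p i) ▸ hP _ h, hP _⟩
  · rw [hp.edgeSide_eq_dualSide hX.isMedianGraph a ha]

lemma IsCAT0.principal_eq_iff (hX : X.IsCAT0) (hPX : ∀ H ∈ P, X.IsHalfspace H)
    (hP : ∀ H ∈ P, Hᶜ ∈ P) (hp : IsCubeMap X.graph p) {a b : ι → Bool} :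
    Sageev.principal P (p a) = Sageev.principal P (p b) ↔
      ∀ i, dualSide X.graph p i ∈ P → a i = b i := by
  constructor
  · intro h i hi
    have hmem : ∀ c, dualSide X.graph p i ∈ Sageev.principal P (p c) ↔ c i = true := fun c =>
      (and_iff_right hi).trans (hp.mem_dualSide hX.isMedianGraph c)
    rw [Bool.eq_iff_iff, ← hmem, ← hmem, h]
  · intro h
    refine eq_of_forall_flipCoord (f := fun a => Sageev.principal P (p a))
      (I := {i | dualSide X.graph p i ∉ P}) (fun a i hi => ?_) fun i hi => h i (not_not.1 hi)
    refine hX.principal_eq_of_adj hPX (hp.adj a i).symm ?_ ?_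
    · have hmem := hX.edgeSide_flipCoord_mem_iff hP hp (flipCoord a i) i
      rw [flipCoord_flipCoord] at hmem
      exact mt hmem.1 hi
    · exact mt (hX.edgeSide_flipCoord_mem_iff hP hp a i).1 hi

/-- The coordinates whose dual half-spaces lie in `P` parametrize the image of the cube. -/
lemma IsCAT0.image_principal_range_mem_cubes (hX : X.IsCAT0) (hPX : ∀ H ∈ P, X.IsHalfspace H)
    (hP : ∀ H ∈ P, Hᶜ ∈ P) (hp : IsCubeMap X.graph p) :
    Sageev.principal P '' Set.range p ∈ Sageev.cubes P := by
  obtain ⟨n, ⟨e⟩⟩ := Finite.exists_equiv_fin {i // dualSide X.graph p i ∈ P}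
  let f : Fin n → ι := fun k => e.symm k
  have hf : Function.Injective f := Subtype.val_injective.comp e.symm.injective
  have hfP : ∀ k, dualSide X.graph p (f k) ∈ P := fun k => (e.symm k).2
  have hfi : ∀ i, dualSide X.graph p i ∈ P → ∃ k, f k = i := fun i hi => ⟨e ⟨i, hi⟩, by simp [f]⟩
  let E (b : Fin n → Bool) : ι → Bool := Function.extend f b fun _ => false
  refine ⟨n, fun b => Sageev.principal P (p (E b)), fun b b' h => funext fun k => ?_, ?_,
    fun b => Sageev.principal_mem_vertices hP _, fun b k => ?_⟩
  · simpa [E, hf.extend_apply] using (hX.principal_eq_iff hPX hP hp).1 h (f k) (hfP k)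
  · refine Set.Subset.antisymm ?_ ?_
    · rintro _ ⟨b, rfl⟩
      exact ⟨_, ⟨_, rfl⟩, rfl⟩
    · rintro _ ⟨_, ⟨a, rfl⟩, rfl⟩
      refine ⟨a ∘ f, (hX.principal_eq_iff hPX hP hp).2 fun i hi => ?_⟩
      obtain ⟨k, rfl⟩ := hfi i hi
      simp [E, hf.extend_apply]
  · change Sageev.Adjacent _ (Sageev.principal P (p (E (flipCoord b k))))
    simp only [E, extend_flipCoord hf]
    exact hX.adjacent_principal hPX hP (hp.adj _ _)
      ((hX.edgeSide_flipCoord_mem_iff hP hp _ _).2 (hfP k))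

lemma IsCAT0.image_principal_mem_cubes (hX : X.IsCAT0) (hPX : ∀ H ∈ P, X.IsHalfspace H)
    (hP : ∀ H ∈ P, Hᶜ ∈ P) {C : Set V} (hC : C ∈ X.cubes) :
    Sageev.principal P '' C ∈ Sageev.cubes P := by
  obtain ⟨n, φ, hφ, rfl⟩ := exists_isChart hC
  exact hX.image_principal_range_mem_cubes hPX hP hφ.isCubeMap

end Projection

section Isometry

variable {g : Equiv.Perm V} {H : Set V}

lemma IsAutomorphism.inv (hg : X.IsAutomorphism g) : X.IsAutomorphism g⁻¹ := fun C => by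
  rw [← hg, Set.image_image]
  simp

lemma IsAutomorphism.zpow (hg : X.IsAutomorphism g) (n : ℤ) : X.IsAutomorphism (g ^ n) := by
  induction n with
  | zero => intro C; simp
  | succ n ih => intro C; rw [zpow_add_one, Equiv.Perm.coe_mul, Set.image_comp, ih, hg]
  | pred n ih => intro C; rw [zpow_sub_one, Equiv.Perm.coe_mul, Set.image_comp, ih, hg.inv]

lemma IsAutomorphism.adj_iff (hg : X.IsAutomorphism g) {x y : V} :
    X.graph.Adj (g x) (g y) ↔ X.graph.Adj x y := by
  change (g x ≠ g y ∧ {g x, g y} ∈ X.cubes) ↔ (x ≠ y ∧ {x, y} ∈ X.cubes)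
  rw [← Set.image_pair, hg, g.injective.ne_iff]

lemma IsAutomorphism.dist_apply_le (hg : X.IsAutomorphism g) (hc : X.graph.Connected) (x y : V) :
    X.graph.dist (g x) (g y) ≤ X.graph.dist x y := by
  obtain ⟨w, hw⟩ := hc.exists_walk_length_eq_dist x y
  let f : X.graph →g X.graph := ⟨g, hg.adj_iff.2⟩
  rw [← hw, ← SimpleGraph.Walk.length_map f w]
  exact SimpleGraph.dist_le (w.map f)

lemma IsAutomorphism.dist_apply (hg : X.IsAutomorphism g) (hc : X.graph.Connected) (x y : V) :
    X.graph.dist (g x) (g y) = X.graph.dist x y :=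
  (hg.dist_apply_le hc x y).antisymm (by simpa using hg.inv.dist_apply_le hc (g x) (g y))

lemma IsAutomorphism.dist_pow_le (hg : X.IsAutomorphism g) (hc : X.graph.Connected) (x : V)
    (n : ℕ) : X.graph.dist x ((g ^ n) x) ≤ n * X.graph.dist x (g x) := by
  induction n with
  | zero => simp
  | succ n ih =>
    calc X.graph.dist x ((g ^ (n + 1)) x)
        ≤ X.graph.dist x (g x) + X.graph.dist (g x) ((g ^ (n + 1)) x) := hc.dist_triangle
      _ = X.graph.dist x (g x) + X.graph.dist x ((g ^ n) x) := by
        rw [pow_succ', Equiv.Perm.mul_apply, hg.dist_apply hc]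
      _ ≤ (n + 1) * X.graph.dist x (g x) := by linarith

lemma IsCAT0.isHalfspace_preimage (hX : X.IsCAT0) (hg : X.IsAutomorphism g)
    (hH : X.IsHalfspace H) : X.IsHalfspace (g ⁻¹' H) := by
  obtain ⟨a, b, hab, rfl⟩ := hX.isHalfspace_iff.1 hH
  refine hX.isHalfspace_iff.2 ⟨g⁻¹ a, g⁻¹ b, hg.inv.adj_iff.2 hab, ?_⟩
  ext v
  rw [Set.mem_preimage, mem_edgeSide, mem_edgeSide, ← hg.dist_apply hX.2.1 v,
    ← hg.dist_apply hX.2.1 v]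
  simp

lemma IsCAT0.preimage_mem_interval_iff (hX : X.IsCAT0) (hg : X.IsAutomorphism g) {x y : V} :
    g ⁻¹' H ∈ X.interval x y ↔ H ∈ X.interval (g x) (g y) := by
  refine and_congr_left fun _ => ⟨fun h => ?_, hX.isHalfspace_preimage hg⟩
  simpa [← Set.preimage_comp] using hX.isHalfspace_preimage hg.inv h

lemma IsCAT0.image_mem_interval (hX : X.IsCAT0) (hg : X.IsAutomorphism g) {x y : V}
    (hH : H ∈ X.interval x y) : g '' H ∈ X.interval (g x) (g y) := by
  rwa [← hX.preimage_mem_interval_iff hg, g.preimage_image]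

end Isometry

section Axis

open Filter

variable {g : Equiv.Perm V} {H : Set V} {γ : ℤ → V}

lemma IsCombinatorialAxis.adj (hγ : X.IsCombinatorialAxis g γ) (i : ℤ) :
    X.graph.Adj (γ i) (γ (i + 1)) := by
  rw [← SimpleGraph.dist_eq_one_iff_adj, hγ.1]
  simp

lemma IsCombinatorialAxis.zpow_apply (hγ : X.IsCombinatorialAxis g γ) (n i : ℤ) :
    (g ^ n) (γ i) = γ (i + n * X.translationDistance g) := by
  induction n generalizing i with
  | zero => simp
  | succ n ih =>
    rw [zpow_add_one, Equiv.Perm.mul_apply, hγ.2, ih]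
    congr 1
    ring
  | pred n ih =>
    have hinv : g⁻¹ (γ i) = γ (i - X.translationDistance g) := by
      rw [Equiv.Perm.inv_eq_iff_eq, hγ.2, sub_add_cancel]
    rw [zpow_sub_one, Equiv.Perm.mul_apply, hinv, ih]
    congr 1
    ring

lemma exists_mem_interval (hH : X.IsHalfspace H) {j k : ℤ} (hjk : j ≤ k) (hj : γ j ∉ H)
    (hk : γ k ∈ H) : ∃ i, H ∈ X.interval (γ i) (γ (i + 1)) := by
  by_contra! h
  suffices ∀ k, j ≤ k → γ k ∉ H from this k hjk hk
  intro k hjk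
  induction k, hjk using Int.leInduction with
  | base => exact hj
  | succ k _ ih => exact fun hk => h k ⟨hH, hk, ih⟩

lemma IsCombinatorialAxis.mem_iff (hγ : X.IsCombinatorialAxis g γ) (hX : X.IsCAT0) {i : ℤ}
    (hi : H ∈ X.interval (γ i) (γ (i + 1))) (j : ℤ) : γ j ∈ H ↔ i < j := by
  obtain ⟨hH, hmem, hnotMem⟩ := hi
  constructor
  · intro hj
    by_contra hij
    refine hnotMem (hX.isGeodConvex hH hj hmem ?_)
    rw [hγ.1, hγ.1, hγ.1]
    omega
  · intro hij
    by_contra hj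
    refine hX.isGeodConvex (hX.isHalfspace_compl hH) hnotMem hj (z := γ (i + 1)) ?_ hmem
    rw [hγ.1, hγ.1, hγ.1]
    omega

lemma IsCombinatorialAxis.image_mem_interval (hγ : X.IsCombinatorialAxis g γ) (hX : X.IsCAT0)
    (hg : X.IsAutomorphism g) {i : ℤ} (hi : H ∈ X.interval (γ i) (γ (i + 1))) :
    g '' H ∈ X.interval (γ (i + X.translationDistance g))
      (γ (i + X.translationDistance g + 1)) := by
  rw [add_right_comm, ← hγ.2, ← hγ.2]
  exact hX.image_mem_interval hg hi

lemma IsCombinatorialAxis.preimage_zpow_mem_interval (hγ : X.IsCombinatorialAxis g γ)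
    (hX : X.IsCAT0) (hg : X.IsAutomorphism g) {i : ℤ} (hi : H ∈ X.interval (γ i) (γ (i + 1)))
    (n : ℤ) : (g ^ n : Equiv.Perm V) ⁻¹' H ∈ X.interval (γ (i - n * X.translationDistance g))
      (γ (i - n * X.translationDistance g + 1)) := by
  rw [hX.preimage_mem_interval_iff (hg.zpow n), hγ.zpow_apply, hγ.zpow_apply]
  convert hi using 2 <;> congr 1 <;> ring

lemma IsCombinatorialAxis.index_unique (hγ : X.IsCombinatorialAxis g γ) (hX : X.IsCAT0)
    {i j : ℤ} (hi : H ∈ X.interval (γ i) (γ (i + 1))) (hj : H ∈ X.interval (γ j) (γ (j + 1))) :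
    i = j := by
  have hij := (hγ.mem_iff hX hi j).not.1 hj.2.2
  have hji := (hγ.mem_iff hX hj i).not.1 hi.2.2
  omega

lemma IsCombinatorialAxis.mul_le_dist_pow (hγ : X.IsCombinatorialAxis g γ)
    (hg : X.IsAutomorphism g) (hc : X.graph.Connected) (x : V) (n : ℕ) :
    n * X.translationDistance g ≤ X.graph.dist x ((g ^ n) x) := by
  have hpow : ∀ m : ℕ, X.IsAutomorphism (g ^ m) := fun m => by simpa using hg.zpow m
  have key : ∀ k : ℕ, k * (n * X.translationDistance g) ≤
      k * X.graph.dist x ((g ^ n) x) + 2 * X.graph.dist (γ 0) x := fun k =>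
    calc k * (n * X.translationDistance g)
        = X.graph.dist (γ 0) ((g ^ (n * k)) (γ 0)) := by
          rw [← zpow_natCast, hγ.zpow_apply, hγ.1, zero_add, zero_sub, Int.natAbs_neg]
          norm_cast
          ring
      _ ≤ X.graph.dist (γ 0) x + X.graph.dist x ((g ^ (n * k)) x) +
          X.graph.dist ((g ^ (n * k)) x) ((g ^ (n * k)) (γ 0)) :=
        hc.dist_triangle.trans (Nat.add_le_add_right hc.dist_triangle _)
      _ ≤ k * X.graph.dist x ((g ^ n) x) + 2 * X.graph.dist (γ 0) x := by
        have h := (hpow n).dist_pow_le hc x k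
        rw [← pow_mul] at h
        rw [(hpow _).dist_apply hc, X.graph.dist_comm (u := x) (v := γ 0)]
        omega
  by_contra! hlt
  nlinarith [key (2 * X.graph.dist (γ 0) x + 1)]

lemma compl_mem_halfspaceAxis (hH : H ∈ X.halfspaceAxis g) : Hᶜ ∈ X.halfspaceAxis g :=
  hH.symm.imp id fun h => by rwa [Set.mem_ofPred_eq, compl_compl]

lemma IsCAT0.isHalfspace_of_mem_halfspaceAxis (hX : X.IsCAT0) (hH : H ∈ X.halfspaceAxis g) :
    X.IsHalfspace H := by
  rcases hH with ⟨-, -, -, hH, -⟩ | ⟨-, -, -, hH, -⟩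
  · exact hH
  · exact compl_compl H ▸ hX.isHalfspace_compl hH

variable (hX : X.IsCAT0) (hg : X.IsAutomorphism g)
include hX hg

lemma image_mem_positiveAxis (hH : H ∈ X.positiveAxis g) : g '' H ∈ X.positiveAxis g :=
  let ⟨γ, hγ, _, hi⟩ := hH
  ⟨γ, hγ, _, hγ.image_mem_interval hX hg hi⟩

lemma image_mem_halfspaceAxis (hH : H ∈ X.halfspaceAxis g) : g '' H ∈ X.halfspaceAxis g := by
  refine hH.imp (image_mem_positiveAxis hX hg) fun h => ?_
  rw [Set.mem_ofPred_eq, ← Set.image_compl_eq g.bijective]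
  exact image_mem_positiveAxis hX hg h

variable (hpos : 0 < X.translationDistance g)
include hpos

/-- An axis enters `H` once, and `g` pushes the crossing forward, so three of the four intersections
are never empty. -/
lemma transverse_image_iff (hH : H ∈ X.positiveAxis g) :
    Transverse H (g '' H) ↔ ¬ g '' H ⊆ H := by
  obtain ⟨γ, hγ, i, hi⟩ := hH
  have mem_iff := hγ.mem_iff hX hi
  have mem_image_iff := hγ.mem_iff hX (hγ.image_mem_interval hX hg hi)
  rw [Set.not_subset]
  refine ⟨fun ⟨_, _, ⟨v, hvH, hv⟩, _⟩ => ⟨v, hv, hvH⟩, fun ⟨v, hv, hvH⟩ =>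
    ⟨⟨γ (i + X.translationDistance g + 1), ?_, ?_⟩, ⟨γ (i + 1), ?_, ?_⟩, ⟨v, hvH, hv⟩,
      ⟨γ i, ?_, ?_⟩⟩⟩
  all_goals simp only [Set.mem_compl_iff, mem_iff, mem_image_iff]; omega

lemma zpow_preimage_injective (hH : H ∈ X.positiveAxis g) :
    Function.Injective fun n : ℤ => (g ^ n : Equiv.Perm V) ⁻¹' H := by
  intro n m hnm
  obtain ⟨γ, hγ, i, hi⟩ := hH
  have hn := hγ.preimage_zpow_mem_interval hX hg hi n
  rw [show (g ^ n : Equiv.Perm V) ⁻¹' H = (g ^ m : Equiv.Perm V) ⁻¹' H from hnm] at hn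
  have hnm := hγ.index_unique hX hn (hγ.preimage_zpow_mem_interval hX hg hi m)
  exact mul_right_cancel₀ (by exact_mod_cast hpos.ne') (sub_right_injective hnm)

lemma finite_setOf_mem_interval_zpow (hH : H ∈ X.positiveAxis g) (x y : V) :
    {n : ℤ | H ∈ X.interval ((g ^ n) x) ((g ^ n) y)}.Finite :=
  ((hX.finite_interval x y).preimage (zpow_preimage_injective hX hg hpos hH).injOn).subset
    fun n => (hX.preimage_mem_interval_iff (hg.zpow n)).2

lemma eventually_zpow_apply_mem (hH : H ∈ X.positiveAxis g) (x : V) :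
    ∀ᶠ n : ℤ in atTop, (g ^ n) x ∈ H := by
  obtain ⟨γ, hγ, i, hi⟩ := id hH
  have hfin := (finite_setOf_mem_interval_zpow hX hg hpos hH x (γ i)).eventually_cofinite_notMem
  rw [Int.cofinite_eq, eventually_sup] at hfin
  filter_upwards [hfin.2, eventually_ge_atTop 1] with n hn hn_pos
  by_contra hx
  refine hn ⟨hi.1, ?_, hx⟩
  rw [hγ.zpow_apply, hγ.mem_iff hX hi]
  nlinarith

lemma eventually_zpow_apply_notMem (hH : H ∈ X.positiveAxis g) (x : V) :
    ∀ᶠ n : ℤ in atBot, (g ^ n) x ∉ H := by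
  obtain ⟨γ, hγ, i, hi⟩ := id hH
  have hfin := (finite_setOf_mem_interval_zpow hX hg hpos hH (γ i) x).eventually_cofinite_notMem
  rw [Int.cofinite_eq, eventually_sup] at hfin
  filter_upwards [hfin.1, eventually_le_atBot 0] with n hn hn_nonpos
  refine fun hx => hn ⟨hi.1, hx, ?_⟩
  rw [hγ.zpow_apply, hγ.mem_iff hX hi]
  nlinarith

lemma IsCombinatorialAxis.mem_interval_of_mem_positiveAxis (hγ : X.IsCombinatorialAxis g γ)
    (hH : H ∈ X.positiveAxis g) : ∃ i, H ∈ X.interval (γ i) (γ (i + 1)) := by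
  obtain ⟨n, hn, hn_nonneg⟩ := ((eventually_zpow_apply_mem hX hg hpos hH (γ 0)).and
    (eventually_ge_atTop 0)).exists
  obtain ⟨m, hm, hm_nonpos⟩ := ((eventually_zpow_apply_notMem hX hg hpos hH (γ 0)).and
    (eventually_le_atBot 0)).exists
  rw [hγ.zpow_apply] at hn hm
  obtain ⟨-, -, -, hH, -⟩ := hH
  exact exists_mem_interval hH (by nlinarith) hm hn

lemma apply_mem_of_dist_eq (hH : H ∈ X.positiveAxis g) {x : V}
    (hx : X.graph.dist x (g x) = X.translationDistance g) (hxH : x ∈ H) : g x ∈ H := by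
  obtain ⟨n, hn, hn_nonneg⟩ := ((eventually_zpow_apply_mem hX hg hpos hH (g x)).and
    (eventually_ge_atTop 0)).exists
  lift n to ℕ using hn_nonneg
  obtain ⟨γ, hγ, -, hH, -⟩ := hH
  refine hX.isGeodConvex hH hxH hn (le_antisymm ?_ hX.2.1.dist_triangle)
  have hle := hg.dist_pow_le hX.2.1 (g x) n
  have hge := hγ.mul_le_dist_pow hg hX.2.1 x (n + 1)
  rw [hg.dist_apply hX.2.1, hx] at hle
  rw [pow_succ, Equiv.Perm.mul_apply] at hge
  rw [hx, zpow_natCast]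
  linarith

end Axis

section ConvexSection

variable {P σ : Set (Set V)} {S : Set V} {v : V}

lemma IsCAT0.finite_sdiff_principal (hX : X.IsCAT0) (hPX : ∀ H ∈ P, X.IsHalfspace H)
    (hσ : σ ∈ Sageev.vertices P) (v : V) : (σ \ Sageev.principal P v).Finite := by
  obtain ⟨⟨hσP, -, -⟩, w, hw⟩ := hσ
  refine (hw.union (hX.finite_interval v w)).subset ?_
  rintro H ⟨hHσ, hHv⟩
  by_cases hwH : w ∈ H
  · exact .inr ⟨hPX H (hσP hHσ), hwH, fun hvH => hHv ⟨hσP hHσ, hvH⟩⟩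
  · exact .inl (.inl ⟨hHσ, fun h => hwH h.2⟩)

/-- Only finitely many half-spaces of `σ` miss `v`. By the Helly property they have a common vertex
in `S`, and the one closest to `v` also lies in the half-spaces of `σ` that contain `v`. -/
lemma IsCAT0.exists_principal_eq (hX : X.IsCAT0) (hPX : ∀ H ∈ P, X.IsHalfspace H)
    (hS : IsGeodConvex X.graph S) (hSP : ∀ H ∈ P, (S ∩ H).Nonempty) (hv : v ∈ S)
    (hσ : σ ∈ Sageev.vertices P) : ∃ w ∈ S, Sageev.principal P w = σ := by
  have hmed := hX.isMedianGraph
  have hfin := hX.finite_sdiff_principal hPX hσ v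
  obtain ⟨hσP, -, hσσ⟩ := hσ.1
  have hconv : ∀ H ∈ σ, IsGeodConvex X.graph H := fun H hH => hX.isGeodConvex (hPX H (hσP hH))
  set F := hfin.toFinset
  have hFσ : ∀ H ∈ F, H ∈ σ := fun H hH => (hfin.mem_toFinset.1 hH).1
  have helly : ∀ {D : Set V}, IsGeodConvex X.graph D → D.Nonempty →
      (∀ H ∈ F, (D ∩ H).Nonempty) → (D ∩ ⋂ H ∈ F, H).Nonempty :=
    hmed.nonempty_inter_biInter F (fun H hH => hconv H (hFσ H hH))
      fun H hH K hK => hσσ H (hFσ H hH) K (hFσ K hK)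
  obtain ⟨w, ⟨hwS, hwF⟩, hgate⟩ := hmed.exists_gate
    (hS.inter (.biInter fun H hH => hconv H (hFσ H hH)))
    (helly hS ⟨v, hv⟩ fun H hH => hSP H (hσP (hFσ H hH))) v
  refine ⟨w, hwS, hσ.1.principal_eq fun K hK => ?_⟩
  by_cases hKF : K ∈ F
  · exact Set.mem_iInter₂.1 hwF K hKF
  have hvK : v ∈ K := by
    by_contra hvK
    exact hKF (hfin.mem_toFinset.2 ⟨hK, fun h => hvK h.2⟩)
  obtain ⟨q, ⟨hqS, hqK⟩, hqF⟩ := helly (hS.inter (hconv K hK)) ⟨v, hv, hvK⟩ fun H hH =>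
    hmed.nonempty_inter_inter hS (hconv K hK) (hconv H (hFσ H hH)) (hSP K (hσP hK))
      (hSP H (hσP (hFσ H hH))) (hσσ K hK H (hFσ H hH))
  exact hconv K hK hvK hqK (hgate q ⟨hqS, hqF⟩)

lemma IsCAT0.adj_of_adjacent_principal (hX : X.IsCAT0)
    (hSP : ∀ x ∈ S, ∀ y ∈ S, X.interval x y ⊆ P) {x y : V} (hx : x ∈ S) (hy : y ∈ S) (hne : x ≠ y)
    (hadj : Sageev.Adjacent (Sageev.principal P x) (Sageev.principal P y)) : X.graph.Adj x y := by
  obtain ⟨H, -, hH⟩ := hadj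
  refine hX.adj_of_interval_subset (H := Hᶜ) hne fun K hK => ?_
  have hKy : K ∈ Sageev.principal P y := ⟨hSP x hx y hy hK, hK.2.1⟩
  rw [hH] at hKy
  exact hKy.resolve_right fun h => hK.2.2 h.1.2

lemma IsCAT0.exists_image_principal_eq (hX : X.IsCAT0) (hPX : ∀ H ∈ P, X.IsHalfspace H)
    (hS : IsGeodConvex X.graph S) (hSP : ∀ H ∈ P, (S ∩ H).Nonempty) (hv : v ∈ S)
    (hPS : ∀ x ∈ S, ∀ y ∈ S, X.interval x y ⊆ P) {Q : Set (Set (Set V))}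
    (hQ : Q ∈ Sageev.cubes P) : ∃ C ∈ X.cubes, C ⊆ S ∧ Q = Sageev.principal P '' C := by
  obtain ⟨n, φ, hφ, rfl, hφP, hφadj⟩ := hQ
  choose p hpS hpφ using fun a => hX.exists_principal_eq hPX hS hSP hv (hφP a)
  have hp_inj : Function.Injective p := fun a b hab => hφ (by rw [← hpφ, hab, hpφ])
  have hp : IsCubeMap X.graph p := by
    refine ⟨hp_inj, fun a i => ?_⟩
    refine hX.adj_of_adjacent_principal hPS (hpS _) (hpS _) (hp_inj.ne (flipCoord_ne a i).symm) ?_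
    rw [hpφ, hpφ]
    exact hφadj a i
  refine ⟨Set.range p, hX.range_mem_cubes hp, Set.range_subset_iff.2 hpS, ?_⟩
  rw [← Set.range_comp]
  exact congrArg Set.range (funext fun a => (hpφ a).symm)

end ConvexSection

section Hull

variable {g : Equiv.Perm V} {H K : Set V} {γ : ℤ → V} {x : V}

/-- The convex hull of `γ`: the intersection of all half-spaces that contain it. -/
def axisHull (X : CubeComplex V) (γ : ℤ → V) : Set V :=
  {v | ∀ H, X.IsHalfspace H → (∀ i, γ i ∈ H) → v ∈ H}

lemma mem_axisHull (i : ℤ) : γ i ∈ X.axisHull γ := fun _ _ h => h i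

lemma IsCAT0.isGeodConvex_axisHull (hX : X.IsCAT0) : IsGeodConvex X.graph (X.axisHull γ) :=
  fun _ hx _ hy _ hz H hH h => hX.isGeodConvex hH (hx H hH h) (hy H hH h) hz

variable (hγ : X.IsCombinatorialAxis g γ) (hX : X.IsCAT0)
include hγ hX

lemma IsCombinatorialAxis.interval_subset_halfspaceAxis {y : V} (hx : x ∈ X.axisHull γ)
    (hy : y ∈ X.axisHull γ) : X.interval x y ⊆ X.halfspaceAxis g := by
  rintro H ⟨hH, hyH, hxH⟩
  obtain ⟨j, hj⟩ : ∃ j, γ j ∉ H := by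
    by_contra! h
    exact hxH (hx H hH h)
  obtain ⟨k, hk⟩ : ∃ k, γ k ∈ H := by
    by_contra! h
    exact hy Hᶜ (hX.isHalfspace_compl hH) h hyH
  rcases le_total j k with hjk | hkj
  · exact .inl ⟨γ, hγ, exists_mem_interval hH hjk hj hk⟩
  · exact .inr ⟨γ, hγ, exists_mem_interval (hX.isHalfspace_compl hH) hkj (not_not.2 hk) hj⟩

lemma IsCombinatorialAxis.image_zpow_eq (hg : X.IsAutomorphism g) {i n : ℤ}
    (hH : H ∈ X.interval (γ i) (γ (i + 1)))
    (hK : K ∈ X.interval (γ (i + n * X.translationDistance g))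
      (γ (i + n * X.translationDistance g + 1))) : (g ^ n : Equiv.Perm V) '' H = K := by
  have hpre := hγ.preimage_zpow_mem_interval hX hg hK n
  rw [add_sub_cancel_right, hX.interval_of_adj (hγ.adj i)] at hpre
  rw [hX.interval_of_adj (hγ.adj i)] at hH
  rw [hH, ← hpre, Equiv.image_preimage]

/-- If `K = gⁿ H` with `n > 0`, then `g x ∈ K` forces `x ∈ gⁿ⁻¹ H ⊆ H`. -/
lemma IsCombinatorialAxis.eq_of_mem_interval_apply (hg : X.IsAutomorphism g)
    (hHsub : g '' H ⊆ H) (hxH : x ∉ H) (hxK : g x ∈ K) {i : ℤ} {n : ℕ}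
    (hH : H ∈ X.interval (γ i) (γ (i + 1)))
    (hK : K ∈ X.interval (γ (i + n * X.translationDistance g))
      (γ (i + n * X.translationDistance g + 1))) : H = K := by
  have hHK := hγ.image_zpow_eq hX hg hH hK
  rw [zpow_natCast] at hHK
  cases n with
  | zero => simpa using hHK
  | succ n =>
    rw [← hHK] at hxK
    obtain ⟨y, hy, hyx⟩ := hxK
    rw [pow_succ', Equiv.Perm.mul_apply, g.apply_eq_iff_eq, ← Equiv.Perm.iterate_eq_pow] at hyx
    exact absurd (hyx ▸ (Set.mapsTo_iff_image_subset.2 hHsub).iterate n hy) hxH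

variable (hg : X.IsAutomorphism g)
include hg

lemma IsCombinatorialAxis.apply_mem_axisHull (hx : x ∈ X.axisHull γ) : g x ∈ X.axisHull γ :=
  fun H hH hγH => hx (g ⁻¹' H) (hX.isHalfspace_preimage hg hH) fun i => by
    rw [Set.mem_preimage, hγ.2]
    exact hγH _

lemma IsCombinatorialAxis.interval_apply_subset_positiveAxis
    (hsub : ∀ H ∈ X.positiveAxis g, g '' H ⊆ H) (hx : x ∈ X.axisHull γ) :
    X.interval x (g x) ⊆ X.positiveAxis g := fun H hH =>
  (hγ.interval_subset_halfspaceAxis hX hx (hγ.apply_mem_axisHull hX hg hx) hH).resolve_right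
    fun h => hsub Hᶜ h (Set.mem_image_of_mem g hH.2.2) hH.2.1

variable (hpos : 0 < X.translationDistance g)
include hpos

lemma IsCombinatorialAxis.axisHull_inter_nonempty (hH : H ∈ X.halfspaceAxis g) :
    (X.axisHull γ ∩ H).Nonempty := by
  rcases hH with hH | hH
  · obtain ⟨i, hi⟩ := hγ.mem_interval_of_mem_positiveAxis hX hg hpos hH
    exact ⟨_, mem_axisHull _, hi.2.1⟩
  · obtain ⟨i, hi⟩ := hγ.mem_interval_of_mem_positiveAxis hX hg hpos hH
    exact ⟨_, mem_axisHull i, not_not.1 hi.2.2⟩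

lemma IsCombinatorialAxis.exists_cube_subset_axisHull {Q : Set (Set (Set V))}
    (hQ : Q ∈ X.essentialCharacteristicSet g) :
    ∃ C ∈ X.cubes, C ⊆ X.axisHull γ ∧ Q = Sageev.principal (X.halfspaceAxis g) '' C :=
  hX.exists_image_principal_eq (fun _ => hX.isHalfspace_of_mem_halfspaceAxis)
    hX.isGeodConvex_axisHull (fun _ => hγ.axisHull_inter_nonempty hX hg hpos) (mem_axisHull 0)
    (fun _ hx _ hy => hγ.interval_subset_halfspaceAxis hX hx hy) hQ

/-- Half-spaces crossed between `x` and `g x` cross the axis at indices that are distinct modulo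
the translation distance. -/
lemma IsCombinatorialAxis.ncard_interval_apply_le (hsub : ∀ H ∈ X.positiveAxis g, g '' H ⊆ H)
    (hx : x ∈ X.axisHull γ) : (X.interval x (g x)).ncard ≤ X.translationDistance g := by
  have hA := hγ.interval_apply_subset_positiveAxis hX hg hsub hx
  choose! f hf using fun H (hH : H ∈ X.interval x (g x)) =>
    hγ.mem_interval_of_mem_positiveAxis hX hg hpos (hA hH)
  have eq_of_index_eq : ∀ H ∈ X.interval x (g x), ∀ K ∈ X.interval x (g x), ∀ n : ℕ,
      f K = f H + n * X.translationDistance g → H = K := fun H hH K hK n hn =>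
    hγ.eq_of_mem_interval_apply hX hg (hsub H (hA hH)) hH.2.2 hK.2.1 (hf H hH) (hn ▸ hf K hK)
  have hcard : (X.interval x (g x)).ncard ≤
      (Finset.Ico (0 : ℤ) (X.translationDistance g) : Set ℤ).ncard := by
    refine Set.ncard_le_ncard_of_injOn (fun H => f H % X.translationDistance g)
      (fun H _ => ?_) (fun H hH K hK hHK => ?_) (Finset.finite_toSet _)
    · rw [Finset.mem_coe, Finset.mem_Ico]
      exact ⟨Int.emod_nonneg _ (by omega), Int.emod_lt_of_pos _ (by omega)⟩
    · obtain ⟨m, hm⟩ := Int.ModEq.dvd hHK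
      obtain ⟨n, rfl | rfl⟩ := m.eq_nat_or_neg
      · exact eq_of_index_eq H hH K hK n (by linarith)
      · exact (eq_of_index_eq K hK H hH n (by linarith)).symm
  simpa only [Set.ncard_coe_finset, Int.card_Ico, sub_zero, Int.toNat_natCast] using hcard

lemma IsCombinatorialAxis.dist_apply_eq_of_mem_axisHull
    (hsub : ∀ H ∈ X.positiveAxis g, g '' H ⊆ H) (hx : x ∈ X.axisHull γ) :
    X.graph.dist x (g x) = X.translationDistance g :=
  le_antisymm ((hX.dist_le_ncard_interval x (g x)).trans
    (hγ.ncard_interval_apply_le hX hg hpos hsub hx)) (Nat.sInf_le ⟨x, rfl⟩)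

end Hull

end CubeComplex

lemma Transverse.compl {V : Type*} {H K : Set V} (h : Transverse H K) : Transverse Hᶜ Kᶜ := by
  obtain ⟨h₁, h₂, h₃, h₄⟩ := h
  rw [Transverse, compl_compl, compl_compl]
  exact ⟨h₄, h₃, h₂, h₁⟩

namespace CubeComplex

variable {V : Type*} {X : CubeComplex V} {g : Equiv.Perm V}

lemma IsCAT0.image_principal_mem_essentialCharacteristicSet (hX : X.IsCAT0) {C : Set V}
    (hC : C ∈ X.cubes) :
    Sageev.principal (X.halfspaceAxis g) '' C ∈ X.essentialCharacteristicSet g :=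
  hX.image_principal_mem_cubes (fun _ => hX.isHalfspace_of_mem_halfspaceAxis)
    (fun _ => compl_mem_halfspaceAxis) hC

lemma IsCAT0.essentialMinimalSet_subset (hX : X.IsCAT0) :
    X.essentialMinimalSet g ⊆ X.essentialCharacteristicSet g := by
  rintro _ ⟨C, ⟨hC, -⟩, rfl⟩
  exact hX.image_principal_mem_essentialCharacteristicSet hC

lemma essentialCharacteristicSet_subset_of_halfspaceAxis_eq_empty [Nonempty V]
    (hA : X.halfspaceAxis g = ∅) : X.essentialCharacteristicSet g ⊆ X.essentialMinimalSet g := by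
  obtain ⟨v, hv⟩ := Nat.sInf_mem (Set.range_nonempty fun v : V => X.graph.dist v (g v))
  have eq_empty : ∀ σ ⊆ X.halfspaceAxis g, σ = ∅ := fun σ hσ => Set.subset_eq_empty hσ hA
  rintro _ ⟨n, φ, -, rfl, hφ, -⟩
  refine ⟨{v}, ⟨X.singleton_mem v, fun w hw => hw ▸ hv⟩, ?_⟩
  rw [Set.image_singleton, eq_empty (Sageev.principal _ v) fun _ => And.left,
    funext fun a => eq_empty (φ a) (hφ a).1.1, Set.range_const]

variable (hX : X.IsCAT0) (hg : X.IsAutomorphism g)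
include hX hg

lemma actsNonTransversely_iff :
    X.ActsNonTransversely g ↔ ∀ H ∈ X.halfspaceAxis g, ¬ Transverse H (g '' H) :=
  forall₂_congr fun _ hH => not_congr <| Sageev.transverseIn_iff
    (fun _ => compl_mem_halfspaceAxis) hH (image_mem_halfspaceAxis hX hg hH)

variable (hpos : 0 < X.translationDistance g)
include hpos

lemma forall_not_transverse_iff :
    (∀ H ∈ X.halfspaceAxis g, ¬ Transverse H (g '' H)) ↔ ∀ H ∈ X.positiveAxis g, g '' H ⊆ H := by
  have iff_of_pos : ∀ H ∈ X.positiveAxis g, ¬ Transverse H (g '' H) ↔ g '' H ⊆ H := fun H hH => by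
    rw [transverse_image_iff hX hg hpos hH, not_not]
  refine ⟨fun h H hH => (iff_of_pos H hH).1 (h H (.inl hH)), fun h H hH => ?_⟩
  rcases hH with hH | hH
  · exact (iff_of_pos H hH).2 (h H hH)
  · refine fun hT => (iff_of_pos Hᶜ hH).2 (h Hᶜ hH) ?_
    rw [Set.image_compl_eq g.bijective]
    exact hT.compl

/-- Every vertex has the same projection as some minimal vertex, and `g` maps the minimal vertices
of `H` into `H`. -/
lemma image_subset_of_essentialCharacteristicSet_subset
    (h : X.essentialCharacteristicSet g ⊆ X.essentialMinimalSet g) {H : Set V}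
    (hH : H ∈ X.positiveAxis g) : g '' H ⊆ H := by
  intro v hv
  obtain ⟨C, ⟨-, hmin⟩, hC⟩ :=
    h (hX.image_principal_mem_essentialCharacteristicSet (X.singleton_mem v))
  rw [Set.image_singleton] at hC
  obtain ⟨x, hxC, hxv⟩ : Sageev.principal (X.halfspaceAxis g) v ∈ _ '' C :=
    hC ▸ Set.mem_singleton _
  have mem_iff : ∀ K ∈ X.positiveAxis g, x ∈ K ↔ v ∈ K := fun K hK => by
    have hKA : K ∈ X.halfspaceAxis g := .inl hK
    simpa only [Sageev.principal, Set.mem_ofPred_eq, hKA, true_and] using Set.ext_iff.1 hxv K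
  obtain ⟨y, hyH, rfl⟩ := (mem_iff _ (image_mem_positiveAxis hX hg hH)).2 hv
  have hy : X.graph.dist y (g y) = X.translationDistance g := by
    rw [← hmin _ hxC, hg.dist_apply hX.2.1]
  exact (mem_iff H hH).1 (apply_mem_of_dist_eq hX hg hpos hH hy hyH)

lemma essentialCharacteristicSet_subset (h : ∀ H ∈ X.positiveAxis g, g '' H ⊆ H) :
    X.essentialCharacteristicSet g ⊆ X.essentialMinimalSet g := by
  by_cases hγ : ∃ γ, X.IsCombinatorialAxis g γ
  · obtain ⟨γ, hγ⟩ := hγ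
    intro Q hQ
    obtain ⟨C, hC, hCγ, rfl⟩ := hγ.exists_cube_subset_axisHull hX hg hpos hQ
    exact ⟨C, ⟨hC, fun v hv => hγ.dist_apply_eq_of_mem_axisHull hX hg hpos h (hCγ hv)⟩, rfl⟩
  · have := hX.2.1.nonempty
    refine essentialCharacteristicSet_subset_of_halfspaceAxis_eq_empty ?_
    rw [Set.eq_empty_iff_forall_notMem]
    rintro H (⟨γ, hγ', -⟩ | ⟨γ, hγ', -⟩) <;> exact hγ ⟨γ, hγ'⟩

end CubeComplex

theorem mainTheorem6_general {V : Type*} (X : CubeComplex V) (hX : X.IsCAT0)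
    (g : Equiv.Perm V) (hg : X.IsAutomorphism g) (hpos : 0 < X.translationDistance g) :
    (X.essentialMinimalSet g = X.essentialCharacteristicSet g ↔ X.ActsNonTransversely g) ∧
      (X.ActsNonTransversely g ↔ ∀ H ∈ X.halfspaceAxis g, ¬ Transverse H (g '' H)) := by
  have hnt := CubeComplex.actsNonTransversely_iff hX hg
  refine ⟨?_, hnt⟩
  rw [hnt, CubeComplex.forall_not_transverse_iff hX hg hpos]
  constructor
  · intro heq H hH
    exact CubeComplex.image_subset_of_essentialCharacteristicSet_subset hX hg hpos heq.ge hH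
  · intro hsub
    exact hX.essentialMinimalSet_subset.antisymm
      (CubeComplex.essentialCharacteristicSet_subset hX hg hpos hsub)

theorem mainTheorem6 {V : Type*} (X : CubeComplex V) (hX : X.IsCAT0)
    (g : Equiv.Perm V) (hg : X.IsHyperbolic g) :
    (X.essentialMinimalSet g = X.essentialCharacteristicSet g ↔ X.ActsNonTransversely g) ∧
      (X.ActsNonTransversely g ↔ ∀ H ∈ X.halfspaceAxis g, ¬ Transverse H (g '' H)) :=
  mainTheorem6_general X hX g hg.isAutomorphism hg.translationDistance_pos
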